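/- Let $A\in\mathbb C^{n\times n}$ have spectrum $\sigma(A)$, let $z_1,\dots,z_N\in\mathbb C$ be (possibly repeated) points, and let $f$ be a function analytic on an open set $U\subseteq\mathbb C$ that contains the convex hull of $\sigma(A)\cup\{z_1,\dots,z_N\}$. Let $u,v$ be complex polynomials with $\deg u\le N-1$, $v(z_k)\ne0$ for $k=1,\dots,N$, and $v(\lambda)\neq0$ for all $\lambda\in\sigma(A)$. Suppose that the rational function $r=u/v$ interpolates $f$ at $z_1,\dots,z_N$ with multiplicities, that is, for every $k$, $$r^{(j)}(z_k)=f^{(j)}(z_k),\qquad 0\le j\le n_k-1,$$ where $n_k$ is the number of indices $i$ with $z_i=z_k$. For a function $g$ analytic on a neighborhood of the spectrum of a square matrix $B$, put $$g(B)=\frac1{2\pi i}\int_\Gamma g(\lambda)(\lambda\mathbf 1-B)^{-1}\,d\lambda,$$ where the contour $\Gamma$ encloses the spectrum of $B$ (for instance, $\Gamma$ consists of sufficiently small positively oriented circles around the eigenvalues of $B$). Let $\Omega(z)=\prod_{k=1}^N(z-z_k)$. Then the matrix $v(A)$ is invertible, the matrix-valued integrand below is defined and continuous on the set $1\ge t_1\ge\dots\ge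 t_N\ge0$, and $$f(A)-r(A)=\Omega(A)\,[v(A)]^{-1}\int_0^1\int_0^{t_1}\!\!\dots\int_0^{t_{N-1}}(vf)^{(N)}\bigl((1-t_1)z_1\mathbf1+(t_1-t_2)z_2\mathbf1+\dots+(t_{N-1}-t_N)z_N\mathbf1+t_NA\bigr)\,dt_N\,dt_{N-1}\dots dt_1 .$$ -/

import Mathlib

noncomputable section

namespace RatInterp

open Complex

/-- The circles of radius `ε` around the eigenvalues of `A` form a contour enclosing the spectrum
of `A` on which the Cauchy integral of `f` may be taken: the closed discs that they bound are
pairwise disjoint, and `f` is analytic on each of these closed discs. -/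
structure IsAdmissibleRadius {n : ℕ} (f : ℂ → ℂ) (A : Matrix (Fin n) (Fin n) ℂ) (ε : ℝ) :
    Prop where
  pos : 0 < ε
  disjoint : (spectrum ℂ A).PairwiseDisjoint (fun μ => Metric.closedBall μ ε)
  analytic : ∀ μ ∈ spectrum ℂ A, AnalyticOnNhd ℂ f (Metric.closedBall μ ε)

/-- `(2πi)⁻¹ ∫_Γ f(w) (w 1 - A)⁻¹ dw`, taken entrywise, where `Γ` is the union of the positively
oriented circles of radius `ε` around the eigenvalues of `A`. -/
def cauchyMatrix {n : ℕ} (f : ℂ → ℂ) (A : Matrix (Fin n) (Fin n) ℂ) (ε : ℝ) :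
    Matrix (Fin n) (Fin n) ℂ :=
  Matrix.of fun i j => (2 * Real.pi * I)⁻¹ *
    ∑ μ ∈ (Matrix.finite_spectrum A).toFinset,
      ∮ w in C(μ, ε), f w * (w • (1 : Matrix (Fin n) (Fin n) ℂ) - A)⁻¹ i j

open Classical in
/-- The analytic function `f` applied to the matrix `A`, that is,
`f(A) = (2πi)⁻¹ ∫_Γ f(w) (w 1 - A)⁻¹ dw` with `Γ` enclosing the spectrum of `A`.
It does not depend on the admissible radius (`matFun_eq_cauchyMatrix`), and an admissible radius
exists when `f` is analytic at all eigenvalues (`exists_isAdmissibleRadius`). -/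
def matFun {n : ℕ} (f : ℂ → ℂ) (A : Matrix (Fin n) (Fin n) ℂ) : Matrix (Fin n) (Fin n) ℂ :=
  if h : ∃ ε, IsAdmissibleRadius f A ε then cauchyMatrix f A h.choose else 0

/-- Multiplicity of the node `z k`: the number of its repetitions in the list `z`. -/
def nodeMult {N : ℕ} (z : Fin N → ℂ) (k : Fin N) : ℕ :=
  (Finset.univ.filter fun i => z i = z k).card

/-- `r` interpolates `f` at the nodes `z`, counted with multiplicities. -/
def Interpolates {N : ℕ} (r f : ℂ → ℂ) (z : Fin N → ℂ) : Prop :=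
  ∀ k : Fin N, ∀ j < nodeMult z k, iteratedDeriv j r (z k) = iteratedDeriv j f (z k)

/-- The polynomial `Ω = ∏ (X - z_k)`. -/
def nodePoly {N : ℕ} (z : Fin N → ℂ) : Polynomial ℂ :=
  ∏ k, (Polynomial.X - Polynomial.C (z k))

/-- The iterated integral
`∫_0^s ∫_0^{t_1} … ∫_0^{t_{N-1}} F(t_1, …, t_N) dt_N … dt_2 dt_1`. -/
def iterIntegral : (N : ℕ) → ((Fin N → ℝ) → ℂ) → ℝ → ℂ
  | 0, F, _ => F Fin.elim0
  | N + 1, F, s => ∫ t in (0 : ℝ)..s, iterIntegral N (fun τ => F (Fin.cons t τ)) t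

/-- The iterated integral of a matrix-valued function, taken entrywise. -/
def iterIntegralMatrix {n : ℕ} (N : ℕ) (F : (Fin N → ℝ) → Matrix (Fin n) (Fin n) ℂ) (s : ℝ) :
    Matrix (Fin n) (Fin n) ℂ :=
  Matrix.of fun i j => iterIntegral N (fun t => F t i j) s

/-- The domain of integration `1 ≥ t_1 ≥ t_2 ≥ … ≥ t_N ≥ 0`. -/
def orderedSimplex (N : ℕ) : Set (Fin N → ℝ) :=
  {t | Antitone t ∧ ∀ k, t k ∈ Set.Icc (0 : ℝ) 1}

/-- The matrix `(1-t_1) z_1 1 + (t_1-t_2) z_2 1 + … + (t_{N-1}-t_N) z_N 1 + t_N A`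
(with `t_0 = 1`). -/
def nodeMatrix {n N : ℕ} (z : Fin N → ℂ) (A : Matrix (Fin n) (Fin n) ℂ) (t : Fin N → ℝ) :
    Matrix (Fin n) (Fin n) ℂ :=
  let s : Fin (N + 1) → ℝ := Fin.cons 1 t
  (∑ k : Fin N, ((s k.castSucc - s k.succ : ℝ) : ℂ) • z k • (1 : Matrix (Fin n) (Fin n) ℂ))
    + (s (Fin.last N) : ℂ) • A

/-- An admissible radius exists as soon as `f` is analytic at the eigenvalues of `A`. -/
theorem exists_isAdmissibleRadius {n : ℕ} {f : ℂ → ℂ} {A : Matrix (Fin n) (Fin n) ℂ}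
    (hf : AnalyticOnNhd ℂ f (spectrum ℂ A)) : ∃ ε, IsAdmissibleRadius f A ε := by
  have hfin := Matrix.finite_spectrum A
  have h1 : ∀ᶠ ε in nhdsWithin (0 : ℝ) (Set.Ioi 0), ∀ μ ∈ spectrum ℂ A,
      AnalyticOnNhd ℂ f (Metric.closedBall μ ε) := by
    rw [Filter.eventually_all_finite hfin]
    intro μ hμ
    obtain ⟨δ, hδ, hball⟩ := Metric.eventually_nhds_iff_ball.1 (hf μ hμ).eventually_analyticAt
    filter_upwards [Ioo_mem_nhdsGT hδ] with ε hε w hw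
    exact hball w (Metric.closedBall_subset_ball hε.2 hw)
  have h2 : ∀ᶠ ε in nhdsWithin (0 : ℝ) (Set.Ioi 0), ∀ μ ∈ spectrum ℂ A, ∀ ν ∈ spectrum ℂ A,
      μ ≠ ν → Disjoint (Metric.closedBall μ ε) (Metric.closedBall ν ε) := by
    rw [Filter.eventually_all_finite hfin]
    intro μ _
    rw [Filter.eventually_all_finite hfin]
    intro ν _
    by_cases h : μ = ν
    · simp [h]
    · have hd : 0 < dist μ ν / 2 := half_pos (dist_pos.2 h)
      filter_upwards [Ioo_mem_nhdsGT hd] with ε hε _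
      exact Metric.closedBall_disjoint_closedBall (by linarith [hε.2])
  obtain ⟨ε, ⟨ha, hb⟩, hc⟩ := ((h1.and h2).and self_mem_nhdsWithin).exists
  exact ⟨ε, hc, fun μ hμ ν hν h => hb μ hμ ν hν h, ha⟩

theorem differentiableAt_resolvent_entry {n : ℕ} {A : Matrix (Fin n) (Fin n) ℂ} (i j : Fin n)
    {w : ℂ} (hw : w ∉ spectrum ℂ A) :
    DifferentiableAt ℂ
      (fun w : ℂ => (w • (1 : Matrix (Fin n) (Fin n) ℂ) - A)⁻¹ i j) w := by
  have hdet : ∀ B : Matrix (Fin n) (Fin n) ℂ,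
      Differentiable ℂ (fun w : ℂ => (w • B - A).det) := by
    intro B
    simp only [Matrix.det_apply, Matrix.sub_apply, Matrix.smul_apply]
    fun_prop
  have hadj : Differentiable ℂ
      (fun w : ℂ => (w • (1 : Matrix (Fin n) (Fin n) ℂ) - A).adjugate i j) := by
    simp only [Matrix.adjugate_apply, Matrix.det_apply]
    have hentry : ∀ a b, Differentiable ℂ (fun w : ℂ =>
        ((w • (1 : Matrix (Fin n) (Fin n) ℂ) - A).updateRow j (Pi.single i 1)) a b) := by
      intro a b
      by_cases h : a = j
      · subst h; simp
      · simp only [Matrix.updateRow_ne h, Matrix.sub_apply, Matrix.smul_apply]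
        fun_prop
    fun_prop
  have hne : (w • (1 : Matrix (Fin n) (Fin n) ℂ) - A).det ≠ 0 := by
    rw [spectrum.notMem_iff, Algebra.algebraMap_eq_smul_one, Matrix.isUnit_iff_isUnit_det] at hw
    exact hw.ne_zero
  have h := ((hdet 1) w).inv hne |>.mul (hadj w)
  simpa [Matrix.inv_def, Pi.mul_def] using h

/-- The Cauchy integral does not depend on the admissible radius. -/
theorem cauchyMatrix_eq {n : ℕ} {f : ℂ → ℂ} {A : Matrix (Fin n) (Fin n) ℂ} {ε δ : ℝ}
    (hε : IsAdmissibleRadius f A ε) (hδ : IsAdmissibleRadius f A δ) :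
    cauchyMatrix f A ε = cauchyMatrix f A δ := by
  wlog h : δ ≤ ε generalizing ε δ
  · exact (this hδ hε (le_of_not_ge h)).symm
  ext i j
  simp only [cauchyMatrix, Matrix.of_apply]
  congr 1
  refine Finset.sum_congr rfl fun μ hμ => ?_
  rw [Set.Finite.mem_toFinset] at hμ
  have key : ∀ w ∈ Metric.closedBall μ ε \ Metric.ball μ δ, DifferentiableAt ℂ
      (fun w => f w * (w • (1 : Matrix (Fin n) (Fin n) ℂ) - A)⁻¹ i j) w := by
    intro w hw
    refine (hε.analytic μ hμ w hw.1).differentiableAt.mul (differentiableAt_resolvent_entry i j ?_)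
    intro hs
    by_cases hwμ : μ = w
    · exact hw.2 (hwμ ▸ Metric.mem_ball_self hδ.pos)
    · exact Set.disjoint_left.1 (hε.disjoint hμ hs hwμ) hw.1 (Metric.mem_closedBall_self hε.pos.le)
  refine Complex.circleIntegral_eq_of_differentiable_on_annulus_off_countable hδ.pos h
    Set.countable_empty (fun w hw => (key w hw).continuousAt.continuousWithinAt) ?_
  intro w hw
  exact key w ⟨Metric.ball_subset_closedBall hw.1.1,
    fun h' => hw.1.2 (Metric.ball_subset_closedBall h')⟩

theorem matFun_eq_cauchyMatrix {n : ℕ} {f : ℂ → ℂ} {A : Matrix (Fin n) (Fin n) ℂ} {ε : ℝ}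
    (hε : IsAdmissibleRadius f A ε) : matFun f A = cauchyMatrix f A ε := by
  have h : ∃ ε, IsAdmissibleRadius f A ε := ⟨ε, hε⟩
  rw [matFun, dif_pos h]
  exact cauchyMatrix_eq h.choose_spec hε

end RatInterp

end

/-! ### Algebra of the contour functional calculus -/

namespace RatInterp

open Complex Set

variable {n : ℕ} {A : Matrix (Fin n) (Fin n) ℂ} {f g : ℂ → ℂ} {ε δ : ℝ}

/-! Put `h = vf`. The formula is Newton interpolation of `h` at the nodes, with the remainder
written as a Genocchi–Hermite integral whose last argument is the matrix `A`; dividing by `v(A)`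
turns it into a statement about `f` and `r`.

The remainder comes from the fundamental theorem of calculus. For fixed outer variables the argument
of `h^(N+1)` moves along a segment of matrices in direction `A - z 1`, where `z` is the last node.
Multiplying by `A - z 1` and integrating over the innermost variable leaves a difference of two
integrals of order `N`: one at `A`, and one at the scalar matrix `z 1`, which is a divided
difference of `h` (`sub_mul_iterIntegralMatrix`). Induction gives `h(A) - p(A) = Ω(A) ∫ h^(N)(…)`
with `deg p < N` (`exists_newton_interpolant`).

To see that `p = u`, apply the same formula to 1×1 matrices: `h - p` is `Ω` times a locally bounded
function, so it vanishes at each node to the order of its multiplicity. So does `h - u = v (f - r)`.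
Hence `p - u` has `N` zeros with multiplicity and degree below `N` (`eq_zero_of_isBigO_nodes`).
Finally `v(A) r(A) = u(A)` and `v(A) f(A) = h(A)`.

The analytic part rests on `matFun_affine`: `g(c 1 + s A)` is the function `w ↦ g(c + s w)` applied
to `A`. All matrices in the integrand are thereby referred to one fixed contour around the spectrum
of `A`, and Fubini's theorem reduces matrix identities to scalar ones. -/

theorem IsAdmissibleRadius.mono (h : IsAdmissibleRadius f A ε) (hδ : 0 < δ) (hle : δ ≤ ε) :
    IsAdmissibleRadius f A δ where
  pos := hδ
  disjoint := h.disjoint.mono_on fun _ _ => Metric.closedBall_subset_closedBall hle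
  analytic μ hμ := (h.analytic μ hμ).mono (Metric.closedBall_subset_closedBall hle)

theorem exists_common_radius (hf : AnalyticOnNhd ℂ f (spectrum ℂ A))
    (hg : AnalyticOnNhd ℂ g (spectrum ℂ A)) :
    ∃ ε, IsAdmissibleRadius f A ε ∧ IsAdmissibleRadius g A ε := by
  obtain ⟨ε, hε⟩ := exists_isAdmissibleRadius hf
  obtain ⟨δ, hδ⟩ := exists_isAdmissibleRadius hg
  have := lt_min hε.pos hδ.pos
  exact ⟨min ε δ, hε.mono this (min_le_left _ _), hδ.mono this (min_le_right _ _)⟩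

/-- A radius depending only on `V` serves every function analytic on `V`, so a whole family of
functions can share one contour. -/
theorem exists_radius_subset {V : Set ℂ} (hV : IsOpen V) (hA : spectrum ℂ A ⊆ V) :
    ∃ ε, 0 < ε ∧ (spectrum ℂ A).PairwiseDisjoint (fun μ => Metric.closedBall μ ε) ∧
      ∀ μ ∈ spectrum ℂ A, Metric.closedBall μ ε ⊆ V := by
  obtain ⟨ε, hε⟩ := exists_isAdmissibleRadius (f := 0) (A := A) (fun _ _ => analyticAt_const)
  obtain ⟨δ, hδ, hδV⟩ := (Matrix.finite_spectrum A).isCompact.exists_cthickening_subset_open hV hA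
  have hm := lt_min hε.pos hδ
  have h := hε.mono hm (min_le_left _ _)
  refine ⟨_, hm, h.disjoint, fun μ hμ => ?_⟩
  exact ((Metric.closedBall_subset_closedBall (min_le_right _ _)).trans
    (Metric.closedBall_subset_cthickening hμ δ)).trans hδV

theorem notMem_spectrum_of_mem_sphere (hpos : 0 < ε)
    (hd : (spectrum ℂ A).PairwiseDisjoint (fun μ => Metric.closedBall μ ε))
    {μ : ℂ} (hμ : μ ∈ spectrum ℂ A) {w : ℂ} (hw : w ∈ Metric.sphere μ ε) :
    w ∉ spectrum ℂ A := by
  intro hs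
  by_cases h : μ = w
  · subst h; simp [hpos.ne] at hw
  · exact Set.disjoint_left.1 (hd hμ hs h) (Metric.sphere_subset_closedBall hw)
      (Metric.mem_closedBall_self hpos.le)

theorem isUnit_sub_of_notMem_spectrum {w : ℂ} (hw : w ∉ spectrum ℂ A) :
    IsUnit (w • (1 : Matrix (Fin n) (Fin n) ℂ) - A) := by
  rwa [spectrum.notMem_iff, Algebra.algebraMap_eq_smul_one] at hw

theorem continuousOn_resolvent_entry (hpos : 0 < ε)
    (hd : (spectrum ℂ A).PairwiseDisjoint (fun μ => Metric.closedBall μ ε))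
    {μ : ℂ} (hμ : μ ∈ spectrum ℂ A) (i j : Fin n) :
    ContinuousOn (fun w : ℂ => (w • (1 : Matrix (Fin n) (Fin n) ℂ) - A)⁻¹ i j)
      (Metric.sphere μ ε) := fun _ hw =>
  (differentiableAt_resolvent_entry i j
    (notMem_spectrum_of_mem_sphere hpos hd hμ hw)).continuousAt.continuousWithinAt

theorem IsAdmissibleRadius.circleIntegrable (h : IsAdmissibleRadius f A ε)
    {μ : ℂ} (hμ : μ ∈ spectrum ℂ A) (i j : Fin n) :
    CircleIntegrable (fun w => f w * (w • (1 : Matrix (Fin n) (Fin n) ℂ) - A)⁻¹ i j) μ ε :=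
  (((h.analytic μ hμ).continuousOn.mono Metric.sphere_subset_closedBall).mul
    (continuousOn_resolvent_entry h.pos h.disjoint hμ i j)).circleIntegrable h.pos.le

theorem matFun_sub (hf : AnalyticOnNhd ℂ f (spectrum ℂ A))
    (hg : AnalyticOnNhd ℂ g (spectrum ℂ A)) :
    matFun (fun w => f w - g w) A = matFun f A - matFun g A := by
  obtain ⟨ε, hfε, hgε⟩ := exists_common_radius hf hg
  have h : IsAdmissibleRadius (fun w => f w - g w) A ε :=
    ⟨hfε.pos, hfε.disjoint, fun μ hμ => (hfε.analytic μ hμ).sub (hgε.analytic μ hμ)⟩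
  rw [matFun_eq_cauchyMatrix hfε, matFun_eq_cauchyMatrix hgε, matFun_eq_cauchyMatrix h]
  ext i j
  simp only [cauchyMatrix, Matrix.sub_apply, Matrix.of_apply, ← mul_sub, ← Finset.sum_sub_distrib]
  congr 1
  refine Finset.sum_congr rfl fun μ hμ => ?_
  rw [Set.Finite.mem_toFinset] at hμ
  rw [← circleIntegral.integral_sub (hfε.circleIntegrable hμ i j) (hgε.circleIntegrable hμ i j)]
  simp only [sub_mul]

theorem matFun_add (hf : AnalyticOnNhd ℂ f (spectrum ℂ A))
    (hg : AnalyticOnNhd ℂ g (spectrum ℂ A)) :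
    matFun (fun w => f w + g w) A = matFun f A + matFun g A := by
  have h := matFun_sub (f := fun w => f w + g w) (hf.add hg) hg
  simp only [add_sub_cancel_right] at h
  rw [h, sub_add_cancel]

theorem matFun_const_mul (hf : AnalyticOnNhd ℂ f (spectrum ℂ A)) (c : ℂ) :
    matFun (fun w => c * f w) A = c • matFun f A := by
  obtain ⟨ε, hfε⟩ := exists_isAdmissibleRadius hf
  have h : IsAdmissibleRadius (fun w => c * f w) A ε :=
    ⟨hfε.pos, hfε.disjoint, fun μ hμ => analyticOnNhd_const.mul (hfε.analytic μ hμ)⟩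
  rw [matFun_eq_cauchyMatrix hfε, matFun_eq_cauchyMatrix h]
  ext i j
  simp only [cauchyMatrix, Matrix.smul_apply, Matrix.of_apply, mul_assoc,
    circleIntegral.integral_const_mul, ← Finset.mul_sum, smul_eq_mul]
  ring

/-- Since `(w 1 - A)(w 1 - A)⁻¹ = 1`, the two integrands differ by `f` times an entry of the
identity, whose integral over each circle is zero by Cauchy's theorem. -/
theorem matFun_id_mul (hf : AnalyticOnNhd ℂ f (spectrum ℂ A)) :
    matFun (fun w => w * f w) A = A * matFun f A := by
  obtain ⟨ε, hfε⟩ := exists_isAdmissibleRadius hf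
  have h : IsAdmissibleRadius (fun w => w * f w) A ε :=
    ⟨hfε.pos, hfε.disjoint, fun μ hμ => analyticOnNhd_id.mul (hfε.analytic μ hμ)⟩
  rw [matFun_eq_cauchyMatrix hfε, matFun_eq_cauchyMatrix h]
  ext i j
  simp only [cauchyMatrix, Matrix.mul_apply, Matrix.of_apply]
  simp only [mul_left_comm (A i _), ← Finset.mul_sum]
  congr 1
  simp only [Finset.mul_sum]
  rw [Finset.sum_comm]
  refine Finset.sum_congr rfl fun μ hμ => ?_
  rw [Set.Finite.mem_toFinset] at hμ
  simp only [← circleIntegral.integral_const_mul]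
  rw [← circleIntegral.integral_fun_sum (fun k _ => by
    simpa using (hfε.circleIntegrable hμ k j).const_fun_smul (a := A i k))]
  rw [← sub_eq_zero, ← circleIntegral.integral_sub (h.circleIntegrable hμ i j)
    (by
      refine CircleIntegrable.fun_sum _ fun k _ => ?_
      simpa using (hfε.circleIntegrable hμ k j).const_fun_smul (a := A i k))]
  have hz : (∮ w in C(μ, ε), f w * (1 : Matrix (Fin n) (Fin n) ℂ) i j) = 0 := by
    refine Complex.circleIntegral_eq_zero_of_differentiable_on_off_countable hfε.pos.le
      Set.countable_empty ((hfε.analytic μ hμ).continuousOn.mul continuousOn_const) ?_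
    intro w hw
    exact (hfε.analytic μ hμ w
      (Metric.ball_subset_closedBall hw.1)).differentiableAt.mul_const _
  rw [← hz]
  refine circleIntegral.integral_congr hfε.pos.le fun w hw => ?_
  have hu := isUnit_sub_of_notMem_spectrum
    (notMem_spectrum_of_mem_sphere hfε.pos hfε.disjoint hμ hw)
  rw [Matrix.isUnit_iff_isUnit_det] at hu
  have h1 := congrFun (congrFun (Matrix.mul_nonsing_inv _ hu) i) j
  rw [sub_mul, smul_mul_assoc, one_mul, Matrix.sub_apply, Matrix.smul_apply, Matrix.mul_apply] at h1
  simp only [← h1, mul_sub, Finset.mul_sum, smul_eq_mul]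
  congr 1
  · ring
  · exact Finset.sum_congr rfl fun _ _ => by ring

theorem matFun_eval_mul (hf : AnalyticOnNhd ℂ f (spectrum ℂ A)) (p : Polynomial ℂ) :
    matFun (fun w => p.eval w * f w) A = Polynomial.aeval A p * matFun f A := by
  have han (q : Polynomial ℂ) : AnalyticOnNhd ℂ (fun w => q.eval w * f w) (spectrum ℂ A) :=
    fun μ hμ => (AnalyticOnNhd.eval_polynomial q μ (mem_univ _)).mul (hf μ hμ)
  induction p using Polynomial.induction_on with
  | C a => simp [matFun_const_mul hf, Algebra.algebraMap_eq_smul_one]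
  | add p q hp hq =>
    simp only [Polynomial.eval_add, add_mul, map_add, ← hp, ← hq]
    exact matFun_add (han p) (han q)
  | monomial k a ih =>
    have h := matFun_id_mul (han (Polynomial.C a * Polynomial.X ^ k))
    rw [ih, ← mul_assoc] at h
    rw [show Polynomial.C a * Polynomial.X ^ (k + 1)
      = Polynomial.X * (Polynomial.C a * Polynomial.X ^ k) by ring]
    simpa [mul_assoc] using h

/-- The functions may differ off `V`, so the radii chosen in `matFun` may be unrelated; both
integrals are moved to circles inside `V`. -/
theorem matFun_congr {V : Set ℂ} (hV : IsOpen V) (hA : spectrum ℂ A ⊆ V)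
    (hf : AnalyticOnNhd ℂ f V) (h : EqOn f g V) : matFun f A = matFun g A := by
  have hg : AnalyticOnNhd ℂ g V := hf.congr hV h
  obtain ⟨ε, hε, hd, hsub⟩ := exists_radius_subset hV hA
  rw [matFun_eq_cauchyMatrix (ε := ε) ⟨hε, hd, fun μ hμ => hf.mono (hsub μ hμ)⟩,
    matFun_eq_cauchyMatrix (ε := ε) ⟨hε, hd, fun μ hμ => hg.mono (hsub μ hμ)⟩]
  ext i j
  simp only [cauchyMatrix, Matrix.of_apply]
  congr 1
  refine Finset.sum_congr rfl fun μ hμ => ?_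
  rw [Set.Finite.mem_toFinset] at hμ
  refine circleIntegral.integral_congr hε.le fun w hw => ?_
  simp only [h (hsub μ hμ (Metric.sphere_subset_closedBall hw))]

end RatInterp

/-! ### Values at constants, polynomials and affine images of the matrix -/

namespace RatInterp

open Complex Set

variable {n : ℕ} {A : Matrix (Fin n) (Fin n) ℂ} {f g : ℂ → ℂ} {ε δ : ℝ}

open Matrix in
-- On a generalized eigenvector the Neumann series of the resolvent around `μ` is finite; applying
-- `w 1 - A = (w - μ) 1 - (A - μ 1)` makes it telescope to `x`.
theorem resolvent_mulVec_of_pow_mulVec_eq_zero {μ w : ℂ} {x : Fin n → ℂ} {k : ℕ}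
    (hx : ((A - μ • 1) ^ k) *ᵥ x = 0) (hw : w ∉ spectrum ℂ A) (hwμ : w ≠ μ) :
    (w • (1 : Matrix (Fin n) (Fin n) ℂ) - A)⁻¹ *ᵥ x =
      ∑ l ∈ Finset.range k, (w - μ) ^ (-(l + 1 : ℤ)) • (((A - μ • 1) ^ l) *ᵥ x) := by
  have hu := isUnit_sub_of_notMem_spectrum hw
  rw [Matrix.isUnit_iff_isUnit_det] at hu
  have hne : w - μ ≠ 0 := sub_ne_zero.2 hwμ
  have key : (w • (1 : Matrix (Fin n) (Fin n) ℂ) - A) *ᵥ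
      (∑ l ∈ Finset.range k, (w - μ) ^ (-(l + 1 : ℤ)) • (((A - μ • 1) ^ l) *ᵥ x)) = x := by
    have hdec : w • (1 : Matrix (Fin n) (Fin n) ℂ) - A = (w - μ) • 1 - (A - μ • 1) := by
      rw [sub_smul]; abel
    rw [Matrix.mulVec_sum]
    have hterm : ∀ l ∈ Finset.range k, (w • (1 : Matrix (Fin n) (Fin n) ℂ) - A) *ᵥ
        ((w - μ) ^ (-(l + 1 : ℤ)) • (((A - μ • 1) ^ l) *ᵥ x)) =
        (w - μ) ^ (-(l : ℤ)) • (((A - μ • 1) ^ l) *ᵥ x) -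
        (w - μ) ^ (-((l + 1 : ℕ) : ℤ)) • (((A - μ • 1) ^ (l + 1)) *ᵥ x) := by
      intro l _
      rw [hdec, Matrix.sub_mulVec, Matrix.mulVec_smul, Matrix.mulVec_smul, Matrix.smul_mulVec,
        Matrix.one_mulVec, Matrix.mulVec_mulVec, ← pow_succ', smul_smul]
      congr 2
      rw [← zpow_add_one₀ hne]
      congr 1
      ring
    rw [Finset.sum_congr rfl hterm,
      Finset.sum_range_sub' (fun l : ℕ => (w - μ) ^ (-(l : ℤ)) • (((A - μ • 1) ^ l) *ᵥ x)), hx]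
    simp
  conv_lhs => rw [← key]
  rw [Matrix.mulVec_mulVec, Matrix.nonsing_inv_mul _ hu, Matrix.one_mulVec]

theorem circleIntegral_sub_zpow_of_notMem_closedBall {μ ν : ℂ} (hε : 0 < ε)
    (h : μ ∉ Metric.closedBall ν ε) (m : ℤ) : (∮ w in C(ν, ε), (w - μ) ^ m) = 0 := by
  have hd : ∀ w ∈ Metric.closedBall ν ε, DifferentiableAt ℂ (fun w : ℂ => (w - μ) ^ m) w := by
    intro w hw
    refine (differentiableAt_id.sub_const μ).zpow (Or.inl (sub_ne_zero.2 ?_))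
    rintro rfl
    exact h hw
  exact Complex.circleIntegral_eq_zero_of_differentiable_on_off_countable hε.le
    Set.countable_empty (fun w hw => (hd w hw).continuousAt.continuousWithinAt)
    fun w hw => hd w (Metric.ball_subset_closedBall hw.1)

open Matrix in
-- Integrating the finite Laurent expansion of the resolvent, only the term `(w - μ)⁻¹` on the
-- circle around `μ` survives. The exponent `k + 1` guarantees that this term is present.
theorem matFun_one_mulVec_of_pow_mulVec_eq_zero {μ : ℂ} (hμ : μ ∈ spectrum ℂ A)
    {x : Fin n → ℂ} {k : ℕ} (hx : ((A - μ • 1) ^ (k + 1)) *ᵥ x = 0) :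
    matFun (fun _ => 1) A *ᵥ x = x := by
  obtain ⟨ε, h⟩ := exists_isAdmissibleRadius (f := fun _ => 1) (A := A)
    (fun _ _ => analyticAt_const)
  rw [matFun_eq_cauchyMatrix h]
  ext i
  have hint : ∀ ν ∈ spectrum ℂ A, ∑ j, (∮ w in C(ν, ε),
      1 * (w • (1 : Matrix (Fin n) (Fin n) ℂ) - A)⁻¹ i j) * x j =
      if ν = μ then 2 * Real.pi * I * x i else 0 := by
    intro ν hν
    have hne : ∀ w ∈ Metric.sphere ν ε, w ≠ μ := fun w hw hwμ =>
      notMem_spectrum_of_mem_sphere h.pos h.disjoint hν hw (hwμ ▸ hμ)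
    have hzint : ∀ l : ℕ, CircleIntegrable (fun w => (w - μ) ^ (-(l + 1 : ℤ))) ν ε := by
      intro l
      refine ContinuousOn.circleIntegrable h.pos.le ?_
      exact (continuousOn_id.sub continuousOn_const).zpow₀ _
        fun w hw => Or.inl (sub_ne_zero.2 (hne w hw))
    have h1 : ∑ j, (∮ w in C(ν, ε), 1 * (w • (1 : Matrix (Fin n) (Fin n) ℂ) - A)⁻¹ i j) * x j =
        ∮ w in C(ν, ε), ∑ l ∈ Finset.range (k + 1),
          (((A - μ • 1) ^ l) *ᵥ x) i * (w - μ) ^ (-(l + 1 : ℤ)) := by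
      simp only [mul_comm _ (x _), ← circleIntegral.integral_const_mul]
      rw [← circleIntegral.integral_fun_sum (fun j _ => by
        simpa using (h.circleIntegrable hν i j).const_fun_smul (a := x j))]
      refine circleIntegral.integral_congr h.pos.le fun w hw => ?_
      have := congrFun (resolvent_mulVec_of_pow_mulVec_eq_zero hx
        (notMem_spectrum_of_mem_sphere h.pos h.disjoint hν hw) (hne w hw)) i
      simp only [Matrix.mulVec, dotProduct, Finset.sum_apply, Pi.smul_apply, smul_eq_mul] at this
      simp only [one_mul, Matrix.mulVec, dotProduct]
      rw [Finset.sum_congr rfl (fun j _ => mul_comm (x j) _), this]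
      exact Finset.sum_congr rfl fun _ _ => mul_comm _ _
    rw [h1, circleIntegral.integral_fun_sum (fun l _ => by
      simpa using (hzint l).const_fun_smul (a := (((A - μ • 1) ^ l) *ᵥ x) i)),
      Finset.sum_range_succ']
    simp only [circleIntegral.integral_const_mul]
    rw [Finset.sum_eq_zero (fun l _ => by
      rw [circleIntegral.integral_sub_zpow_of_ne (by omega), mul_zero]), zero_add]
    split_ifs with hνμ
    · subst hνμ
      simp [circleIntegral.integral_sub_center_inv _ h.pos.ne', mul_comm]
    · rw [circleIntegral_sub_zpow_of_notMem_closedBall h.pos, mul_zero]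
      exact fun hm => Set.disjoint_left.1 (h.disjoint hν hμ hνμ) hm
        (Metric.mem_closedBall_self h.pos.le)
  simp only [Matrix.mulVec, dotProduct, cauchyMatrix, Matrix.of_apply, mul_assoc, Finset.sum_mul,
    ← Finset.mul_sum]
  rw [Finset.sum_comm, Finset.sum_congr rfl
    (fun ν hν => hint ν ((Set.Finite.mem_toFinset _).1 hν)), Finset.sum_ite_eq', if_pos (by simpa)]
  field_simp [Real.pi_ne_zero, I_ne_zero]

/-- Generalized eigenvectors span the space, so it suffices to test on them; for `μ` outside the
spectrum the generalized eigenspace is zero. -/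
theorem matFun_one : matFun (fun _ => 1) A = 1 := by
  suffices h : ⊤ ≤ LinearMap.eqLocus (Matrix.toLin' (matFun (fun _ => 1) A)) LinearMap.id by
    apply Matrix.toLin'.injective
    rw [Matrix.toLin'_one]
    exact LinearMap.eqLocus_eq_top.1 (top_le_iff.1 h)
  rw [← Module.End.iSup_maxGenEigenspace_eq_top (Matrix.toLin' A)]
  refine iSup_le fun μ x hx => ?_
  obtain ⟨k, hk⟩ := (Module.End.mem_maxGenEigenspace _ _ _).1 hx
  have hx' : ((A - μ • 1) ^ k).mulVec x = 0 := by
    rw [← hk, ← Matrix.toLin'_apply, Matrix.toLin'_pow, map_sub, map_smul, Matrix.toLin'_one]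
    rfl
  rw [LinearMap.mem_eqLocus, Matrix.toLin'_apply, LinearMap.id_apply]
  by_cases hμ : μ ∈ spectrum ℂ A
  · refine matFun_one_mulVec_of_pow_mulVec_eq_zero (k := k) hμ ?_
    rw [pow_succ', ← Matrix.mulVec_mulVec, hx', Matrix.mulVec_zero]
  · have hu : IsUnit ((A - μ • 1) ^ k) := by
      have := (isUnit_sub_of_notMem_spectrum hμ).neg
      rw [neg_sub] at this
      exact this.pow k
    rw [Matrix.isUnit_iff_isUnit_det] at hu
    have : x = 0 := by
      rw [← Matrix.one_mulVec x, ← Matrix.nonsing_inv_mul _ hu, ← Matrix.mulVec_mulVec, hx',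
        Matrix.mulVec_zero]
    rw [this, Matrix.mulVec_zero]

theorem matFun_const (c : ℂ) : matFun (fun _ => c) A = c • 1 := by
  have := matFun_const_mul (A := A) (f := fun _ => 1) (fun _ _ => analyticAt_const) c
  rwa [matFun_one, funext (fun _ : ℂ => mul_one c)] at this

theorem matFun_eval (p : Polynomial ℂ) : matFun (fun w => p.eval w) A = Polynomial.aeval A p := by
  have := matFun_eval_mul (A := A) (f := fun _ => 1) (fun _ _ => analyticAt_const) p
  simpa [matFun_one] using this

theorem spectrum_smul_one_subset (c : ℂ) :
    spectrum ℂ (c • (1 : Matrix (Fin n) (Fin n) ℂ)) ⊆ {c} := by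
  intro w hw
  by_contra h
  refine spectrum.mem_iff.1 hw ?_
  rw [Algebra.algebraMap_eq_smul_one, ← sub_smul]
  exact isUnit_one.smul (Units.mk0 (w - c) (sub_ne_zero.2 h))

/-- Write `g(w) = g(c) + (w - c) q(w)` with `q` analytic at `c`; the factor `w - c` becomes the zero
matrix at `c 1`. -/
theorem matFun_smul_one {c : ℂ} (hg : AnalyticAt ℂ g c) :
    matFun g (c • (1 : Matrix (Fin n) (Fin n) ℂ)) = g c • 1 := by
  have hsp := spectrum_smul_one_subset (n := n) c
  obtain ⟨q, hq⟩ := hg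
  have hqa : AnalyticOnNhd ℂ (dslope g c) (spectrum ℂ (c • (1 : Matrix (Fin n) (Fin n) ℂ))) := by
    intro w hw
    rw [hsp hw]
    exact ⟨_, hq.has_fpower_series_dslope_fslope⟩
  have h1 := matFun_eval_mul hqa (Polynomial.X - Polynomial.C c)
  have h2 : g = fun w => g c + (Polynomial.X - Polynomial.C c).eval w * dslope g c w := by
    ext w
    have := sub_smul_dslope g c w
    simp only [smul_eq_mul] at this
    simp [this]
  have h3 : Polynomial.aeval (c • (1 : Matrix (Fin n) (Fin n) ℂ))
      (Polynomial.X - Polynomial.C c) = 0 := by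
    simp [Algebra.algebraMap_eq_smul_one]
  rw [h3, zero_mul] at h1
  have h4 : AnalyticOnNhd ℂ (fun w => (Polynomial.X - Polynomial.C c).eval w * dslope g c w)
      (spectrum ℂ (c • (1 : Matrix (Fin n) (Fin n) ℂ))) := fun w hw =>
    (AnalyticOnNhd.eval_polynomial _ w (mem_univ _)).mul (hqa w hw)
  conv_lhs => rw [h2]
  rw [matFun_add (f := fun _ => g c) (fun _ _ => analyticAt_const) h4, h1, matFun_const, add_zero]

theorem spectrum_smul_one_add_smul (c : ℂ) {s : ℂ} (hs : s ≠ 0) :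
    spectrum ℂ (c • (1 : Matrix (Fin n) (Fin n) ℂ) + s • A) =
      (fun w => c + s * w) '' spectrum ℂ A := by
  have key (w : ℂ) : c + s * w ∈ spectrum ℂ (c • (1 : Matrix (Fin n) (Fin n) ℂ) + s • A) ↔
      w ∈ spectrum ℂ A := by
    rw [spectrum.mem_iff, spectrum.mem_iff, Algebra.algebraMap_eq_smul_one,
      Algebra.algebraMap_eq_smul_one, show (c + s * w) • (1 : Matrix (Fin n) (Fin n) ℂ)
        - (c • 1 + s • A) = Units.mk0 s hs • (w • 1 - A) by
        rw [Units.smul_mk0, add_smul, mul_smul, smul_sub]; abel, isUnit_smul_iff]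
  ext w
  constructor
  · intro hw
    refine ⟨(w - c) / s, (key _).1 ?_, ?_⟩
    · rwa [mul_div_cancel₀ _ hs, add_sub_cancel]
    · simp only [mul_div_cancel₀ _ hs, add_sub_cancel]
  · rintro ⟨w, hw, rfl⟩
    exact (key w).2 hw

/-- Substitution `w ↦ c + s w`: circles of radius `ε / s` around the eigenvalues of `A` go to
circles of radius `ε` with the same angle, and the Jacobian `s` cancels the factor `1 / s` from the
resolvent. -/
theorem matFun_affine_of_pos (c : ℂ) {s : ℝ} (hs : 0 < s)
    (hg : ∀ μ ∈ spectrum ℂ A, AnalyticAt ℂ g (c + s * μ)) :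
    matFun g (c • (1 : Matrix (Fin n) (Fin n) ℂ) + (s : ℂ) • A) =
      matFun (fun w => g (c + s * w)) A := by
  have hs' : (s : ℂ) ≠ 0 := ofReal_ne_zero.2 hs.ne'
  have hsp := spectrum_smul_one_add_smul (A := A) c hs'
  have hcomp : ∀ w : ℂ, AnalyticAt ℂ g (c + s * w) →
      AnalyticAt ℂ (fun w => g (c + s * w)) w := fun w hw =>
    AnalyticAt.fun_comp hw (analyticAt_const.add (analyticAt_const.mul analyticAt_id))
  obtain ⟨ε, hε⟩ := exists_isAdmissibleRadius (f := g)
    (A := c • (1 : Matrix (Fin n) (Fin n) ℂ) + (s : ℂ) • A) (by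
      rw [hsp]; rintro _ ⟨μ, hμ, rfl⟩; exact hg μ hμ)
  have hmem : ∀ μ w : ℂ, w ∈ Metric.closedBall μ (ε / s) →
      c + s * w ∈ Metric.closedBall (c + s * μ) ε := by
    intro μ w hw
    rw [Metric.mem_closedBall, dist_add_left, dist_eq_norm, ← mul_sub, norm_mul, norm_real,
      Real.norm_of_nonneg hs.le, ← dist_eq_norm]
    rw [Metric.mem_closedBall, le_div_iff₀ hs] at hw
    linarith
  have hmemsp : ∀ μ ∈ spectrum ℂ A,
      c + s * μ ∈ spectrum ℂ (c • (1 : Matrix (Fin n) (Fin n) ℂ) + (s : ℂ) • A) := by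
    intro μ hμ
    rw [hsp]
    exact ⟨μ, hμ, rfl⟩
  have hinj : Function.Injective fun w : ℂ => c + s * w := fun a b hab =>
    mul_left_cancel₀ hs' (add_left_cancel hab)
  have hδ : IsAdmissibleRadius (fun w => g (c + s * w)) A (ε / s) := by
    refine ⟨div_pos hε.pos hs, fun μ hμ ν hν hne => ?_, fun μ hμ w hw => ?_⟩
    · refine Set.disjoint_left.2 fun w h1 h2 => ?_
      exact Set.disjoint_left.1 (hε.disjoint (hmemsp μ hμ) (hmemsp ν hν) (hinj.ne hne))
        (hmem μ w h1) (hmem ν w h2)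
    · exact hcomp w (hε.analytic _ (hmemsp μ hμ) _ (hmem μ w hw))
  rw [matFun_eq_cauchyMatrix hε, matFun_eq_cauchyMatrix hδ]
  ext i j
  simp only [cauchyMatrix, Matrix.of_apply]
  congr 1
  symm
  refine Finset.sum_bij (fun μ _ => c + s * μ) ?_ (fun _ _ _ _ h => hinj h) ?_ ?_
  · intro μ hμ
    rw [Set.Finite.mem_toFinset] at hμ ⊢
    exact hmemsp μ hμ
  · intro ν hν
    rw [Set.Finite.mem_toFinset, hsp] at hν
    obtain ⟨μ, hμ, rfl⟩ := hν
    exact ⟨μ, by rwa [Set.Finite.mem_toFinset], rfl⟩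
  · intro μ hμ
    rw [Set.Finite.mem_toFinset] at hμ
    simp only [circleIntegral, deriv_circleMap, smul_eq_mul]
    refine intervalIntegral.integral_congr fun θ _ => ?_
    have h0 : circleMap 0 ε θ = s * circleMap 0 (ε / s) θ := by
      simp only [circleMap, zero_add, ofReal_div]
      field_simp
    have h1 : circleMap (c + s * μ) ε θ = c + s * circleMap μ (ε / s) θ := by
      rw [← circleMap_sub_center (c + s * μ), ← circleMap_sub_center μ] at h0
      linear_combination h0
    have hu := isUnit_sub_of_notMem_spectrum (notMem_spectrum_of_mem_sphere hδ.pos hδ.disjoint hμ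
      (circleMap_mem_sphere μ hδ.pos.le θ))
    rw [Matrix.isUnit_iff_isUnit_det] at hu
    simp only [h0, h1]
    rw [show (c + s * circleMap μ (ε / s) θ) • (1 : Matrix (Fin n) (Fin n) ℂ)
        - (c • 1 + (s : ℂ) • A) = Units.mk0 (s : ℂ) hs' • (circleMap μ (ε / s) θ • 1 - A) by
        rw [Units.smul_mk0, add_smul, mul_smul, smul_sub]; abel, Matrix.inv_smul' _ _ hu]
    simp only [Matrix.smul_apply, Units.smul_def, smul_eq_mul, Units.val_inv_eq_inv_val,
      Units.val_mk0]
    field_simp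

/-- At `s = 0` the substitution degenerates, but both sides are `g(c) 1`. Analyticity at `c` is then
read off from any eigenvalue, so matrices of size zero are treated apart. -/
theorem matFun_affine (c : ℂ) {s : ℝ} (hs : 0 ≤ s)
    (hg : ∀ μ ∈ spectrum ℂ A, AnalyticAt ℂ g (c + s * μ)) :
    matFun g (c • (1 : Matrix (Fin n) (Fin n) ℂ) + (s : ℂ) • A) =
      matFun (fun w => g (c + s * w)) A := by
  obtain rfl | h := hs.eq_or_lt
  · cases isEmpty_or_nonempty (Fin n)
    · exact Subsingleton.elim _ _
    · obtain ⟨μ, hμ⟩ := spectrum.nonempty_of_isAlgClosed_of_finiteDimensional ℂ A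
      have hc : AnalyticAt ℂ g c := by simpa using hg μ hμ
      simp [matFun_const, matFun_smul_one hc]
  · exact matFun_affine_of_pos c h hg

end RatInterp

/-! ### Contour integrals depending on a parameter -/

namespace RatInterp

open Complex Set

variable {n : ℕ} {A : Matrix (Fin n) (Fin n) ℂ} {V : Set ℂ}

theorem continuous_comp_circleMap_mul_resolvent {X : Type*} [TopologicalSpace X] {F : X → ℂ → ℂ}
    {ε : ℝ} (hε : 0 < ε) (hd : (spectrum ℂ A).PairwiseDisjoint fun μ => Metric.closedBall μ ε)
    (hsub : ∀ μ ∈ spectrum ℂ A, Metric.closedBall μ ε ⊆ V)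
    (hF : ContinuousOn (Function.uncurry F) (univ ×ˢ V)) {μ : ℂ} (hμ : μ ∈ spectrum ℂ A)
    (i j : Fin n) :
    Continuous fun p : X × ℝ => deriv (circleMap μ ε) p.2 • (F p.1 (circleMap μ ε p.2) *
      (circleMap μ ε p.2 • (1 : Matrix (Fin n) (Fin n) ℂ) - A)⁻¹ i j) := by
  have hc : Continuous fun p : X × ℝ => circleMap μ ε p.2 :=
    (continuous_circleMap μ ε).comp continuous_snd
  have hc0 : Continuous fun p : X × ℝ => circleMap 0 ε p.2 :=
    (continuous_circleMap 0 ε).comp continuous_snd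
  have hs : ∀ p : X × ℝ, circleMap μ ε p.2 ∈ Metric.sphere μ ε := fun p =>
    circleMap_mem_sphere μ hε.le p.2
  simp only [deriv_circleMap]
  refine (hc0.mul continuous_const).smul (Continuous.mul ?_ ?_)
  · exact hF.comp_continuous (continuous_fst.prodMk hc)
      fun p => ⟨mem_univ _, hsub μ hμ (Metric.sphere_subset_closedBall (hs p))⟩
  · exact (continuousOn_resolvent_entry hε hd hμ i j).comp_continuous hc hs

/-- Continuous dependence of `f(A)` on `f`. -/
theorem continuous_matFun {X : Type*} [TopologicalSpace X] [FirstCountableTopology X]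
    {F : X → ℂ → ℂ} (hV : IsOpen V) (hA : spectrum ℂ A ⊆ V)
    (hF : ContinuousOn (Function.uncurry F) (univ ×ˢ V)) (hFa : ∀ x, AnalyticOnNhd ℂ (F x) V) :
    Continuous fun x => matFun (F x) A := by
  obtain ⟨ε, hε, hd, hsub⟩ := exists_radius_subset hV hA
  have hx : ∀ x, matFun (F x) A = cauchyMatrix (F x) A ε := fun x =>
    matFun_eq_cauchyMatrix ⟨hε, hd, fun μ hμ => (hFa x).mono (hsub μ hμ)⟩
  simp only [hx]
  refine continuous_matrix fun i j => ?_
  simp only [cauchyMatrix, Matrix.of_apply]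
  refine continuous_const.mul (continuous_finsetSum _ fun μ hμ => ?_)
  rw [Set.Finite.mem_toFinset] at hμ
  exact intervalIntegral.continuous_parametric_intervalIntegral_of_continuous'
    (continuous_comp_circleMap_mul_resolvent hε hd hsub hF hμ i j) _ _

theorem continuousOn_matFun {X : Type*} [TopologicalSpace X] [FirstCountableTopology X]
    {F : X → ℂ → ℂ} {s : Set X} (hV : IsOpen V) (hA : spectrum ℂ A ⊆ V)
    (hF : ContinuousOn (Function.uncurry F) (s ×ˢ V)) (hFa : ∀ x ∈ s, AnalyticOnNhd ℂ (F x) V) :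
    ContinuousOn (fun x => matFun (F x) A) s := by
  rw [continuousOn_iff_continuous_domRestrict]
  refine continuous_matFun (F := fun x : s => F x) hV hA ?_ fun x => hFa x x.2
  exact hF.comp (f := Prod.map Subtype.val id) (by fun_prop) fun p hp => ⟨p.1.2, hp.2⟩

/-- Integration with respect to a parameter commutes with the Cauchy integral. -/
theorem integral_matFun_apply {F : ℝ → ℂ → ℂ} {G : ℂ → ℂ} {τ : ℝ} (hτ : 0 ≤ τ) (hV : IsOpen V)
    (hA : spectrum ℂ A ⊆ V) (hF : ContinuousOn (Function.uncurry F) (Icc 0 τ ×ˢ V))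
    (hFa : ∀ x ∈ Icc 0 τ, AnalyticOnNhd ℂ (F x) V) (hG : AnalyticOnNhd ℂ G V)
    (hFG : ∀ w ∈ V, ∫ x in (0 : ℝ)..τ, F x w = G w) (i j : Fin n) :
    ∫ x in (0 : ℝ)..τ, matFun (F x) A i j = matFun G A i j := by
  obtain ⟨ε, hε, hd, hsub⟩ := exists_radius_subset hV hA
  have hx : ∀ x ∈ Icc 0 τ, matFun (F x) A = cauchyMatrix (F x) A ε := fun x hx =>
    matFun_eq_cauchyMatrix ⟨hε, hd, fun μ hμ => (hFa x hx).mono (hsub μ hμ)⟩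
  have hcont : ∀ μ ∈ spectrum ℂ A, Continuous fun p : Icc 0 τ × ℝ =>
      deriv (circleMap μ ε) p.2 • (F p.1 (circleMap μ ε p.2) *
        (circleMap μ ε p.2 • (1 : Matrix (Fin n) (Fin n) ℂ) - A)⁻¹ i j) := fun μ hμ =>
    continuous_comp_circleMap_mul_resolvent (F := fun x : Icc 0 τ => F x) hε hd hsub
      (hF.comp (f := Prod.map Subtype.val id) (by fun_prop) fun p hp => ⟨p.1.2, hp.2⟩) hμ i j
  rw [matFun_eq_cauchyMatrix (f := G) ⟨hε, hd, fun μ hμ => hG.mono (hsub μ hμ)⟩,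
    intervalIntegral.integral_congr (g := fun x => cauchyMatrix (F x) A ε i j)
      (fun x hxm => by rw [uIcc_of_le hτ] at hxm; simp only [hx x hxm])]
  simp only [cauchyMatrix, Matrix.of_apply]
  rw [intervalIntegral.integral_const_mul, intervalIntegral.integral_finsetSum]
  · congr 1
    refine Finset.sum_congr rfl fun μ hμ => ?_
    rw [Set.Finite.mem_toFinset] at hμ
    simp only [circleIntegral]
    -- Once the contour is independent of `x`, Fubini applies on a compact rectangle where the
    -- integrand is continuous.
    rw [MeasureTheory.intervalIntegral_intervalIntegral_swap]
    · refine intervalIntegral.integral_congr fun θ _ => ?_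
      simp only [smul_eq_mul]
      rw [intervalIntegral.integral_const_mul, intervalIntegral.integral_mul_const, hFG _
        (hsub μ hμ (Metric.sphere_subset_closedBall (circleMap_mem_sphere μ hε.le θ)))]
    · rw [uIoc_of_le hτ]
      refine MeasureTheory.IntegrableOn.mono_set (t := Icc 0 τ ×ˢ uIcc 0 (2 * Real.pi)) ?_
        (prod_mono Ioc_subset_Icc_self uIoc_subset_uIcc)
      refine ContinuousOn.integrableOn_compact (isCompact_Icc.prod isCompact_uIcc) ?_
      rw [continuousOn_iff_continuous_domRestrict]
      exact (hcont μ hμ).comp (f := fun p : (Icc 0 τ ×ˢ uIcc 0 (2 * Real.pi) : Set (ℝ × ℝ)) =>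
        ((⟨p.1.1, p.2.1⟩ : Icc 0 τ), p.1.2)) (by fun_prop)
  · intro μ hμ
    rw [Set.Finite.mem_toFinset] at hμ
    refine ContinuousOn.intervalIntegrable ?_
    rw [uIcc_of_le hτ, continuousOn_iff_continuous_domRestrict]
    exact intervalIntegral.continuous_parametric_intervalIntegral_of_continuous'
      (hcont μ hμ) _ _

end RatInterp

/-! ### Iterated integrals over the ordered simplex -/

namespace RatInterp

open Complex Set

/-- The set `s ≥ t_1 ≥ … ≥ t_N ≥ 0`. -/
def scaledSimplex (N : ℕ) (s : ℝ) : Set (Fin N → ℝ) :=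
  {t | Antitone t ∧ ∀ k, t k ∈ Icc (0 : ℝ) s}

theorem isClosed_scaledSimplex (N : ℕ) (s : ℝ) : IsClosed (scaledSimplex N s) := by
  simp only [scaledSimplex, Antitone, ofPred_and, ofPred_forall]
  refine IsClosed.inter ?_ ?_
  · exact isClosed_iInter fun i => isClosed_iInter fun j => isClosed_iInter fun _ =>
      isClosed_le (continuous_apply j) (continuous_apply i)
  · exact isClosed_iInter fun i => isClosed_Icc.preimage (continuous_apply i)

theorem cons_mem_scaledSimplex {N : ℕ} {s t : ℝ} (ht : t ∈ Icc 0 s) {τ : Fin N → ℝ}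
    (hτ : τ ∈ scaledSimplex N t) : (Fin.cons t τ : Fin (N + 1) → ℝ) ∈ scaledSimplex (N + 1) s := by
  constructor
  · intro i j hij
    induction i using Fin.cases with
    | zero =>
      induction j using Fin.cases with
      | zero => simp
      | succ j => simpa using (hτ.2 j).2
    | succ i =>
      induction j using Fin.cases with
      | zero => simp at hij
      | succ j => simpa using hτ.1 (Fin.succ_le_succ_iff.1 hij)
  · intro k
    induction k using Fin.cases with
    | zero => simpa using ht
    | succ k => simpa using ⟨(hτ.2 k).1, (hτ.2 k).2.trans ht.2⟩

theorem iterIntegral_congr {N : ℕ} {F G : (Fin N → ℝ) → ℂ} {s : ℝ} (hs : 0 ≤ s)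
    (h : EqOn F G (scaledSimplex N s)) : iterIntegral N F s = iterIntegral N G s := by
  induction N generalizing s with
  | zero => exact h ⟨fun i => i.elim0, fun k => k.elim0⟩
  | succ N ih =>
    refine intervalIntegral.integral_congr fun t ht => ?_
    rw [uIcc_of_le hs] at ht
    exact ih ht.1 fun τ hτ => h (cons_mem_scaledSimplex ht hτ)

/-- The parameter space is arbitrary so that the induction can absorb the outer integration variable
into it, both as a parameter and as the next upper limit. -/
theorem continuous_iterIntegral {N : ℕ} {X : Type*} [TopologicalSpace X]
    [FirstCountableTopology X] {F : X → (Fin N → ℝ) → ℂ} {s : X → ℝ}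
    (hF : Continuous (Function.uncurry F)) (hs : Continuous s) :
    Continuous fun x => iterIntegral N (F x) (s x) := by
  induction N generalizing X with
  | zero => exact hF.comp (continuous_id.prodMk continuous_const)
  | succ N ih =>
    refine intervalIntegral.continuous_parametric_intervalIntegral_of_continuous
      (f := fun x t => iterIntegral N (fun τ => F x (Fin.cons t τ)) t) ?_ hs
    refine ih (F := fun (p : X × ℝ) τ => F p.1 (Fin.cons p.2 τ)) ?_ continuous_snd
    exact hF.comp (f := fun q : (X × ℝ) × (Fin N → ℝ) =>
      (q.1.1, (Fin.cons q.1.2 q.2 : Fin (N + 1) → ℝ))) (by fun_prop)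

theorem norm_iterIntegral_le {N : ℕ} {F : (Fin N → ℝ) → ℂ} {s M : ℝ} (hs : s ∈ Icc (0 : ℝ) 1)
    (h : ∀ t ∈ scaledSimplex N s, ‖F t‖ ≤ M) : ‖iterIntegral N F s‖ ≤ M := by
  induction N generalizing s with
  | zero => exact h _ ⟨fun i => i.elim0, fun k => k.elim0⟩
  | succ N ih =>
    have hb : ∀ t ∈ Icc 0 s, ‖iterIntegral N (fun τ => F (Fin.cons t τ)) t‖ ≤ M := fun t ht =>
      ih ⟨ht.1, ht.2.trans hs.2⟩ fun τ hτ => h _ (cons_mem_scaledSimplex ht hτ)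
    have hM : 0 ≤ M := (norm_nonneg _).trans (hb 0 ⟨le_rfl, hs.1⟩)
    refine (intervalIntegral.norm_integral_le_of_norm_le_const (C := M) fun t ht => ?_).trans ?_
    · rw [uIoc_of_le hs.1] at ht
      exact hb t (Ioc_subset_Icc_self ht)
    · rw [sub_zero, abs_of_nonneg hs.1]
      exact mul_le_of_le_one_right hM hs.2

theorem iterIntegral_sum_of_continuous {N : ℕ} {ι : Type*} (S : Finset ι)
    {F : ι → (Fin N → ℝ) → ℂ} (hF : ∀ k, Continuous (F k)) (a : ι → ℂ) (s : ℝ) :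
    iterIntegral N (fun t => ∑ k ∈ S, a k * F k t) s = ∑ k ∈ S, a k * iterIntegral N (F k) s := by
  induction N generalizing s with
  | zero => rfl
  | succ N ih =>
    have hc : ∀ k, Continuous fun t => iterIntegral N (fun τ => F k (Fin.cons t τ)) t := fun k =>
      continuous_iterIntegral (F := fun (t : ℝ) τ => F k (Fin.cons t τ))
        ((hF k).comp (by fun_prop)) continuous_id
    simp only [iterIntegral, ← intervalIntegral.integral_const_mul]
    rw [← intervalIntegral.integral_finsetSum fun k _ =>
      ((hc k).const_mul (a k)).intervalIntegrable _ _]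
    refine intervalIntegral.integral_congr fun t _ => ?_
    exact ih (fun k => (hF k).comp (by fun_prop)) t

/-- Linearity needs integrability at every level. Tietze's theorem extends the integrands
continuously from the closed simplex to the whole space, without changing the integrals, and there
every partial integral is continuous. -/
theorem iterIntegral_sum {N : ℕ} {ι : Type*} (S : Finset ι) {F : ι → (Fin N → ℝ) → ℂ} {s : ℝ}
    (hs : 0 ≤ s) (hF : ∀ k, ContinuousOn (F k) (scaledSimplex N s)) (a : ι → ℂ) :
    iterIntegral N (fun t => ∑ k ∈ S, a k * F k t) s = ∑ k ∈ S, a k * iterIntegral N (F k) s := by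
  have hext : ∀ k, ∃ G : C(Fin N → ℝ, ℂ), EqOn (F k) G (scaledSimplex N s) := fun k => by
    obtain ⟨G, hG⟩ := ContinuousMap.exists_restrict_eq (isClosed_scaledSimplex N s)
      ⟨(scaledSimplex N s).domRestrict (F k), (hF k).domRestrict⟩
    exact ⟨G, fun t ht => (DFunLike.congr_fun hG ⟨t, ht⟩).symm⟩
  choose G hG using hext
  rw [iterIntegral_congr hs (G := fun t => ∑ k ∈ S, a k * G k t) fun t ht =>
      Finset.sum_congr rfl fun k _ => by rw [hG k ht],
    iterIntegral_sum_of_continuous S (fun k => (G k).continuous) a s]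
  exact Finset.sum_congr rfl fun k _ => by rw [iterIntegral_congr hs (hG k)]

theorem iterIntegral_sub {N : ℕ} {F G : (Fin N → ℝ) → ℂ} {s : ℝ} (hs : 0 ≤ s)
    (hF : ContinuousOn F (scaledSimplex N s)) (hG : ContinuousOn G (scaledSimplex N s)) :
    iterIntegral N (fun t => F t - G t) s = iterIntegral N F s - iterIntegral N G s := by
  have h := iterIntegral_sum (N := N) (F := ![F, G]) (Finset.univ : Finset (Fin 2)) hs
    (fun k => by fin_cases k <;> simpa) ![1, -1]
  simpa [Fin.sum_univ_two, sub_eq_add_neg] using h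

/-- The innermost integration is carried out first. -/
theorem iterIntegral_succ_last {N : ℕ} (F : (Fin (N + 1) → ℝ) → ℂ) (s : ℝ) :
    iterIntegral (N + 1) F s = iterIntegral N
      (fun t => ∫ x in (0 : ℝ)..(Fin.cons s t : Fin (N + 1) → ℝ) (Fin.last N),
        F (Fin.snoc t x)) s := by
  induction N generalizing s with
  | zero =>
    simp only [iterIntegral]
    refine intervalIntegral.integral_congr fun t _ => ?_
    congr 1
    ext i
    fin_cases i
    simp [Fin.snoc]
  | succ N ih =>
    rw [iterIntegral]
    refine intervalIntegral.integral_congr fun t _ => ?_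
    simp only [ih]
    congr 1
    ext τ
    rw [← Fin.succ_last, Fin.cons_succ]
    simp only [← Fin.cons_snoc_eq_snoc_cons]

theorem mul_iterIntegralMatrix {n N : ℕ} {F : (Fin N → ℝ) → Matrix (Fin n) (Fin n) ℂ} {s : ℝ}
    (hs : 0 ≤ s) (hF : ContinuousOn F (scaledSimplex N s)) (B : Matrix (Fin n) (Fin n) ℂ) :
    B * iterIntegralMatrix N F s = iterIntegralMatrix N (fun t => B * F t) s := by
  ext i j
  simp only [Matrix.mul_apply, iterIntegralMatrix, Matrix.of_apply]
  refine (iterIntegral_sum _ hs (fun k => ?_) _).symm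
  exact (continuous_apply_apply k j).comp_continuousOn hF

theorem iterIntegralMatrix_sub {n N : ℕ} {F G : (Fin N → ℝ) → Matrix (Fin n) (Fin n) ℂ} {s : ℝ}
    (hs : 0 ≤ s) (hF : ContinuousOn F (scaledSimplex N s))
    (hG : ContinuousOn G (scaledSimplex N s)) :
    iterIntegralMatrix N (fun t => F t - G t) s =
      iterIntegralMatrix N F s - iterIntegralMatrix N G s := by
  ext i j
  exact iterIntegral_sub hs ((continuous_apply_apply i j).comp_continuousOn hF)
    ((continuous_apply_apply i j).comp_continuousOn hG)

end RatInterp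

/-! ### The matrices in the integrand and integration along a segment -/

namespace RatInterp

open Complex Set

/-- The parameter `t_N`, with `t_0 = 1`. -/
noncomputable def lastParam {N : ℕ} (t : Fin N → ℝ) : ℝ :=
  (Fin.cons 1 t : Fin (N + 1) → ℝ) (Fin.last N)

/-- The point `(1-t_1) z_1 + (t_1-t_2) z_2 + … + (t_{N-1}-t_N) z_N`. -/
noncomputable def nodeCenter {N : ℕ} (z : Fin N → ℂ) (t : Fin N → ℝ) : ℂ :=
  ∑ k : Fin N, (((Fin.cons 1 t : Fin (N + 1) → ℝ) k.castSucc
    - (Fin.cons 1 t : Fin (N + 1) → ℝ) k.succ : ℝ) : ℂ) * z k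

theorem nodeMatrix_eq {n N : ℕ} (z : Fin N → ℂ) (A : Matrix (Fin n) (Fin n) ℂ) (t : Fin N → ℝ) :
    nodeMatrix z A t = nodeCenter z t • 1 + (lastParam t : ℂ) • A := by
  simp only [nodeMatrix, nodeCenter, lastParam, Finset.sum_smul, smul_smul]

theorem continuous_lastParam {N : ℕ} : Continuous (lastParam : (Fin N → ℝ) → ℝ) := by
  unfold lastParam
  fun_prop

theorem continuous_nodeCenter {N : ℕ} (z : Fin N → ℂ) : Continuous (nodeCenter z) := by
  unfold nodeCenter
  fun_prop

theorem lastParam_snoc {N : ℕ} (t : Fin N → ℝ) (x : ℝ) :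
    lastParam (Fin.snoc t x : Fin (N + 1) → ℝ) = x := by
  rw [lastParam, Fin.cons_snoc_eq_snoc_cons, Fin.snoc_last]

/-- Isolates the innermost variable `x`: with the others fixed, the argument of the integrand is
affine in `x`. -/
theorem nodeCenter_snoc {N : ℕ} (z : Fin (N + 1) → ℂ) (t : Fin N → ℝ) (x : ℝ) :
    nodeCenter z (Fin.snoc t x : Fin (N + 1) → ℝ) =
      nodeCenter (fun k => z k.castSucc) t + (lastParam t - x) * z (Fin.last N) := by
  simp only [nodeCenter, lastParam, Fin.cons_snoc_eq_snoc_cons, Fin.sum_univ_castSucc,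
    Fin.succ_castSucc, Fin.snoc_castSucc, Fin.succ_last, Fin.snoc_last, ofReal_sub]

theorem antitone_cons_one {N : ℕ} {t : Fin N → ℝ} (ht : t ∈ orderedSimplex N) :
    (Fin.cons 1 t : Fin (N + 1) → ℝ) ∈ orderedSimplex (N + 1) :=
  cons_mem_scaledSimplex (s := 1) ⟨zero_le_one, le_rfl⟩ ht

theorem lastParam_mem {N : ℕ} {t : Fin N → ℝ} (ht : t ∈ orderedSimplex N) :
    lastParam t ∈ Icc (0 : ℝ) 1 := (antitone_cons_one ht).2 _

theorem snoc_mem_orderedSimplex {N : ℕ} {t : Fin N → ℝ} (ht : t ∈ orderedSimplex N) {x : ℝ}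
    (hx : x ∈ Icc 0 (lastParam t)) : (Fin.snoc t x : Fin (N + 1) → ℝ) ∈ orderedSimplex (N + 1) := by
  have hle : ∀ i, x ≤ t i := fun i => by
    have := (antitone_cons_one ht).1 (Fin.le_last i.succ)
    rw [Fin.cons_succ] at this
    exact hx.2.trans this
  constructor
  · intro i j hij
    induction j using Fin.lastCases with
    | last =>
      induction i using Fin.lastCases with
      | last => simp
      | cast i => simpa using hle i
    | cast j =>
      induction i using Fin.lastCases with
      | last => exact absurd (hij.trans_lt (Fin.castSucc_lt_last j)) (lt_irrefl _)
      | cast i => simpa using ht.1 (Fin.castSucc_le_castSucc_iff.1 hij)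
  · intro k
    induction k using Fin.lastCases with
    | last => simpa using ⟨hx.1, hx.2.trans (lastParam_mem ht).2⟩
    | cast k => simpa using ht.2 k

theorem sum_castSucc_sub_succ {N : ℕ} (s : Fin (N + 1) → ℝ) :
    ∑ k : Fin N, (s k.castSucc - s k.succ) = s 0 - s (Fin.last N) := by
  induction N with
  | zero => simp
  | succ N ih =>
    have := ih fun k => s k.castSucc
    rw [Fin.sum_univ_castSucc]
    simp only [Fin.succ_castSucc, Fin.succ_last, this, Fin.castSucc_zero]
    ring

/-- The point is a convex combination: the weights are nonnegative by monotonicity of the `t_k`, and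
they telescope to `1`. -/
theorem nodeCenter_add_mem {N : ℕ} {V : Set ℂ} (hV : Convex ℝ V) {z : Fin N → ℂ}
    (hz : ∀ k, z k ∈ V) {w : ℂ} (hw : w ∈ V) {t : Fin N → ℝ} (ht : t ∈ orderedSimplex N) :
    nodeCenter z t + lastParam t * w ∈ V := by
  have hs := antitone_cons_one ht
  have h := hV.sum_mem (t := Finset.univ) (z := fun k : Fin (N + 1) => (Fin.snoc z w : _ → ℂ) k)
    (w := fun k : Fin (N + 1) => (Fin.snoc (fun k : Fin N => (Fin.cons 1 t : Fin (N + 1) → ℝ)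
      k.castSucc - (Fin.cons 1 t : Fin (N + 1) → ℝ) k.succ) (lastParam t) : _ → ℝ) k)
    (by
      intro k _
      induction k using Fin.lastCases with
      | last => simpa using (lastParam_mem ht).1
      | cast k => simpa using hs.1 (Fin.castSucc_le_succ k))
    (by
      rw [Fin.sum_univ_castSucc]
      simp only [Fin.snoc_castSucc, Fin.snoc_last, sum_castSucc_sub_succ]
      simp [lastParam])
    (by
      intro k _
      induction k using Fin.lastCases with
      | last => simpa using hw
      | cast k => simpa using hz k)
  rw [Fin.sum_univ_castSucc] at h
  simpa [nodeCenter] using h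

variable {n : ℕ} {A : Matrix (Fin n) (Fin n) ℂ} {V : Set ℂ} {g : ℂ → ℂ}

/-- Moves the dependence on `t` from the matrix to the function, so that the contour no longer
varies with `t`. -/
theorem matFun_nodeMatrix {N : ℕ} (hVc : Convex ℝ V) (hA : spectrum ℂ A ⊆ V)
    (hg : AnalyticOnNhd ℂ g V) {z : Fin N → ℂ} (hz : ∀ k, z k ∈ V) {t : Fin N → ℝ}
    (ht : t ∈ orderedSimplex N) :
    matFun g (nodeMatrix z A t) = matFun (fun w => g (nodeCenter z t + lastParam t * w)) A := by
  rw [nodeMatrix_eq, matFun_affine _ (lastParam_mem ht).1]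
  exact fun μ hμ => hg _ (nodeCenter_add_mem hVc hz (hA hμ) ht)

theorem continuousOn_matFun_nodeMatrix {N : ℕ} (hVo : IsOpen V) (hVc : Convex ℝ V)
    (hA : spectrum ℂ A ⊆ V) (hg : AnalyticOnNhd ℂ g V) {z : Fin N → ℂ} (hz : ∀ k, z k ∈ V) :
    ContinuousOn (fun t => matFun g (nodeMatrix z A t)) (orderedSimplex N) := by
  refine ContinuousOn.congr ?_ fun t ht => matFun_nodeMatrix hVc hA hg hz ht
  refine continuousOn_matFun (F := fun t w => g (nodeCenter z t + lastParam t * w)) hVo hA ?_ ?_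
  · have hc := continuous_nodeCenter z
    have hl := continuous_lastParam (N := N)
    refine hg.continuousOn.comp
      (f := fun p : (Fin N → ℝ) × ℂ => nodeCenter z p.1 + lastParam p.1 * p.2)
      (by fun_prop) fun p hp => nodeCenter_add_mem hVc hz hp.2 hp.1
  · intro t ht w hw
    exact AnalyticAt.fun_comp (hg _ (nodeCenter_add_mem hVc hz hw ht))
      (analyticAt_const.add (analyticAt_const.mul analyticAt_id))

theorem integral_sub_mul_deriv_segment (hg : AnalyticOnNhd ℂ g V) {c z w : ℂ} {τ : ℝ}
    (hτ : 0 ≤ τ) (h : ∀ x ∈ Icc 0 τ, c + (τ - x) * z + x * w ∈ V) :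
    ∫ x in (0 : ℝ)..τ, (w - z) * deriv g (c + (τ - x) * z + x * w) =
      g (c + τ * w) - g (c + τ * z) := by
  have hd : ∀ x ∈ uIcc 0 τ, HasDerivAt (fun x : ℝ => g (c + (τ - x) * z + x * w))
      ((w - z) * deriv g (c + (τ - x) * z + x * w)) x := by
    intro x hx
    rw [uIcc_of_le hτ] at hx
    have h1 : HasDerivAt (fun y : ℂ => c + (τ - y) * z + y * w) (w - z) (x : ℂ) := by
      have := ((((hasDerivAt_id (x : ℂ)).const_sub (τ : ℂ)).mul_const z).const_add c).add
        ((hasDerivAt_id (x : ℂ)).mul_const w)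
      refine this.congr_deriv ?_
      ring
    have h2 := (hg _ (h x hx)).differentiableAt.hasDerivAt.comp (x : ℂ) h1
    rw [mul_comm] at h2
    exact h2.comp_ofReal
  rw [intervalIntegral.integral_eq_sub_of_hasDerivAt hd]
  · simp
  · refine ContinuousOn.intervalIntegrable ?_
    rw [uIcc_of_le hτ]
    refine continuousOn_const.mul (hg.deriv.continuousOn.comp (by fun_prop) h)

/-- The fundamental theorem of calculus along the segment from `(c + τ z) 1` to `c 1 + τ A`. -/
theorem integral_sub_mul_matFun_deriv (hVo : IsOpen V) (hA : spectrum ℂ A ⊆ V)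
    (hg : AnalyticOnNhd ℂ g V) {c z : ℂ} (hz : z ∈ V) {τ : ℝ} (hτ : 0 ≤ τ)
    (h : ∀ x ∈ Icc 0 τ, ∀ w ∈ V, c + (τ - x) * z + x * w ∈ V) (i j : Fin n) :
    ∫ x in (0 : ℝ)..τ,
      ((A - z • 1) * matFun (deriv g) ((c + (τ - x) * z) • 1 + (x : ℂ) • A) :
        Matrix (Fin n) (Fin n) ℂ) i j =
      (matFun g (c • 1 + (τ : ℂ) • A) - matFun g (c • 1 + (τ : ℂ) • z • 1) :
        Matrix (Fin n) (Fin n) ℂ) i j := by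
  have hdg := hg.deriv
  have hτV : ∀ w ∈ V, c + τ * w ∈ V := fun w hw => by simpa using h τ ⟨hτ, le_rfl⟩ w hw
  have han : ∀ x ∈ Icc 0 τ,
      AnalyticOnNhd ℂ (fun w => deriv g (c + (τ - x) * z + x * w)) V := fun x hx w hw =>
    AnalyticAt.fun_comp (hdg _ (h x hx w hw))
      (analyticAt_const.add (analyticAt_const.mul analyticAt_id))
  have hanτ : AnalyticOnNhd ℂ (fun w => g (c + τ * w)) V := fun w hw =>
    AnalyticAt.fun_comp (hg _ (hτV w hw))
      (analyticAt_const.add (analyticAt_const.mul analyticAt_id))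
  have hcont : ContinuousOn
      (fun p : ℝ × ℂ => deriv g (c + (τ - p.1) * z + p.1 * p.2)) (Icc 0 τ ×ˢ V) :=
    hdg.continuousOn.comp (by fun_prop) fun p hp => h p.1 hp.1 p.2 hp.2
  -- The factor `A - z 1` is absorbed as the polynomial `w - z`, which turns the integrand into the
  -- derivative in the scalar computation.
  have hmul : ∀ x ∈ Icc 0 τ,
      (A - z • 1) * matFun (deriv g) ((c + (τ - x) * z) • 1 + (x : ℂ) • A) =
      matFun (fun w => (w - z) * deriv g (c + (τ - x) * z + x * w)) A := by
    intro x hx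
    rw [matFun_affine _ hx.1 fun μ hμ => hdg _ (h x hx μ (hA hμ))]
    have := matFun_eval_mul ((han x hx).mono hA) (Polynomial.X - Polynomial.C z)
    simpa [Algebra.algebraMap_eq_smul_one] using this.symm
  have hrhs : matFun g (c • 1 + (τ : ℂ) • A) - matFun g (c • 1 + (τ : ℂ) • z • 1) =
      matFun (fun w => g (c + τ * w) - g (c + τ * z)) A := by
    rw [matFun_sub (hanτ.mono hA) (fun _ _ => analyticAt_const), matFun_const,
      matFun_affine _ hτ fun μ hμ => hg _ (hτV μ (hA hμ)), smul_smul, ← add_smul,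
      matFun_smul_one (hg _ (hτV z hz))]
  rw [hrhs, ← integral_matFun_apply
    (F := fun x w => (w - z) * deriv g (c + (τ - x) * z + x * w))
    (G := fun w => g (c + τ * w) - g (c + τ * z))
    hτ hVo hA ((by fun_prop : ContinuousOn (fun p : ℝ × ℂ => p.2 - z) _).mul hcont)
    (fun x hx w hw => (analyticAt_id.sub analyticAt_const).mul (han x hx w hw))
    (fun w hw => (hanτ w hw).sub analyticAt_const)
    (fun w hw => integral_sub_mul_deriv_segment hg hτ fun x hx => h x hx w hw) i j]
  refine intervalIntegral.integral_congr fun x hx => ?_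
  rw [uIcc_of_le hτ] at hx
  simp only [hmul x hx]

end RatInterp

/-! ### Newton's formula and uniqueness of the Hermite interpolant -/

namespace RatInterp

open Complex Set

theorem iterIntegral_mul_const {N : ℕ} (F : (Fin N → ℝ) → ℂ) (a : ℂ) (s : ℝ) :
    iterIntegral N (fun t => F t * a) s = iterIntegral N F s * a := by
  induction N generalizing s with
  | zero => rfl
  | succ N ih =>
    simp only [iterIntegral, ih]
    exact intervalIntegral.integral_mul_const _ _

/-- The divided difference of `h` at `z_1, …, z_N, w` in the Genocchi–Hermite form. -/
noncomputable def genocchiHermite {N : ℕ} (h : ℂ → ℂ) (z : Fin N → ℂ) (w : ℂ) : ℂ :=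
  iterIntegral N (fun t => iteratedDeriv N h (nodeCenter z t + lastParam t * w)) 1

variable {V : Set ℂ} {h : ℂ → ℂ}

theorem _root_.AnalyticOnNhd.iteratedDeriv_complex (hh : AnalyticOnNhd ℂ h V) (N : ℕ) :
    AnalyticOnNhd ℂ (iteratedDeriv N h) V := by
  rw [iteratedDeriv_eq_iterate]
  exact hh.iterated_deriv N

theorem iterIntegralMatrix_smul_one {n N : ℕ} (hVc : Convex ℝ V) (hh : AnalyticOnNhd ℂ h V)
    {z : Fin N → ℂ} (hz : ∀ k, z k ∈ V) {w : ℂ} (hw : w ∈ V) :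
    iterIntegralMatrix N (fun t => matFun (iteratedDeriv N h)
      (nodeMatrix z (w • (1 : Matrix (Fin n) (Fin n) ℂ)) t)) 1 = genocchiHermite h z w • 1 := by
  ext i j
  simp only [iterIntegralMatrix, Matrix.of_apply, genocchiHermite, Matrix.smul_apply, smul_eq_mul]
  rw [← iterIntegral_mul_const]
  refine iterIntegral_congr zero_le_one fun t ht => ?_
  have := hh.iteratedDeriv_complex N _ (nodeCenter_add_mem hVc hz hw ht)
  simp only [nodeMatrix_eq, smul_smul, ← add_smul, matFun_smul_one this, Matrix.smul_apply,
    smul_eq_mul]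

theorem nodePoly_succ {N : ℕ} (z : Fin (N + 1) → ℂ) : nodePoly z =
    nodePoly (fun k => z k.castSucc) * (Polynomial.X - Polynomial.C (z (Fin.last N))) := by
  rw [nodePoly, nodePoly, Fin.prod_univ_castSucc]

theorem degree_nodePoly {N : ℕ} (z : Fin N → ℂ) : (nodePoly z).degree = N := by
  simp [nodePoly, Polynomial.degree_prod]

/-- Raising the order of a divided difference with the matrix argument `A`. -/
theorem sub_mul_iterIntegralMatrix {n N : ℕ} (hVo : IsOpen V) (hVc : Convex ℝ V)
    (hh : AnalyticOnNhd ℂ h V) {z : Fin (N + 1) → ℂ} (hz : ∀ k, z k ∈ V)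
    {A : Matrix (Fin n) (Fin n) ℂ} (hA : spectrum ℂ A ⊆ V) :
    (A - z (Fin.last N) • 1) * iterIntegralMatrix (N + 1)
      (fun t => matFun (iteratedDeriv (N + 1) h) (nodeMatrix z A t)) 1 =
    iterIntegralMatrix N (fun t => matFun (iteratedDeriv N h)
      (nodeMatrix (fun k => z k.castSucc) A t)) 1 -
      genocchiHermite h (fun k => z k.castSucc) (z (Fin.last N)) • 1 := by
  have hz' : ∀ k : Fin N, z k.castSucc ∈ V := fun k => hz _
  have hb : spectrum ℂ (z (Fin.last N) • (1 : Matrix (Fin n) (Fin n) ℂ)) ⊆ V :=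
    (spectrum_smul_one_subset _).trans (singleton_subset_iff.2 (hz _))
  have hN := hh.iteratedDeriv_complex N
  rw [mul_iterIntegralMatrix zero_le_one (continuousOn_matFun_nodeMatrix hVo hVc hA
      (hh.iteratedDeriv_complex (N + 1)) hz),
    -- The divided difference is rewritten as an iterated integral at the scalar matrix of the last
    -- node, so that the identity can be checked under the outer integrals.
    ← iterIntegralMatrix_smul_one hVc hh hz' (hz (Fin.last N)),
    ← iterIntegralMatrix_sub zero_le_one (continuousOn_matFun_nodeMatrix hVo hVc hA hN hz')
      (continuousOn_matFun_nodeMatrix hVo hVc hb hN hz')]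
  ext i j
  simp only [iterIntegralMatrix, Matrix.of_apply]
  rw [iterIntegral_succ_last]
  refine iterIntegral_congr zero_le_one fun t ht => ?_
  simp only [nodeMatrix_eq, nodeCenter_snoc, lastParam_snoc, iteratedDeriv_succ]
  refine integral_sub_mul_matFun_deriv hVo hA hN (hz (Fin.last N)) (lastParam_mem ht).1 ?_ i j
  intro x hx w hw
  have := nodeCenter_add_mem hVc hz hw (snoc_mem_orderedSimplex ht hx)
  rwa [nodeCenter_snoc, lastParam_snoc] at this

/-- Newton's interpolation formula with the remainder of Genocchi–Hermite type. -/
theorem exists_newton_interpolant (hVo : IsOpen V) (hVc : Convex ℝ V) (hh : AnalyticOnNhd ℂ h V)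
    {N : ℕ} {z : Fin N → ℂ} (hz : ∀ k, z k ∈ V) :
    ∃ p : Polynomial ℂ, p.degree < N ∧
      ∀ (n : ℕ) (A : Matrix (Fin n) (Fin n) ℂ), spectrum ℂ A ⊆ V →
        Polynomial.aeval A (nodePoly z) * iterIntegralMatrix N
          (fun t => matFun (iteratedDeriv N h) (nodeMatrix z A t)) 1 =
        matFun h A - Polynomial.aeval A p := by
  induction N with
  | zero =>
    refine ⟨0, by simp, fun n A hA => ?_⟩
    ext i j
    simp [nodePoly, iterIntegralMatrix, iterIntegral, nodeMatrix]
  | succ N ih =>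
    obtain ⟨p, hp, hpA⟩ := ih (z := fun k => z k.castSucc) fun k => hz _
    -- The next Newton term: a divided difference times the product over the earlier nodes.
    refine ⟨p + Polynomial.C (genocchiHermite h (fun k => z k.castSucc) (z (Fin.last N))) *
      nodePoly fun k => z k.castSucc, ?_, fun n A hA => ?_⟩
    · have hlt : (N : WithBot ℕ) < (N + 1 : ℕ) := by exact_mod_cast N.lt_succ_self
      refine (Polynomial.degree_add_le _ _).trans_lt (max_lt (hp.trans hlt) ?_)
      rw [← Polynomial.smul_eq_C_mul]
      refine (Polynomial.degree_smul_le _ _).trans_lt ?_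
      rwa [degree_nodePoly]
    · have h1 := sub_mul_iterIntegralMatrix hVo hVc hh hz hA
      have h2 := hpA n A hA
      rw [nodePoly_succ, map_mul, map_sub, Polynomial.aeval_X, Polynomial.aeval_C,
        Algebra.algebraMap_eq_smul_one, mul_assoc, h1, mul_sub, h2, map_add, map_mul,
        Polynomial.aeval_C, Algebra.algebraMap_eq_smul_one, smul_mul_assoc, one_mul,
        mul_smul_comm, mul_one, sub_sub]

theorem isCompact_orderedSimplex (N : ℕ) : IsCompact (orderedSimplex N) := by
  refine IsCompact.of_isClosed_subset
    (isCompact_univ_pi fun _ : Fin N => isCompact_Icc (a := (0 : ℝ)) (b := 1))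
    (isClosed_scaledSimplex N 1) fun t ht k _ => ht.2 k

open Asymptotics Topology in
-- The integrand is bounded on the compact product of the simplex with a small closed disc, and the
-- iterated integral inherits the bound because every interval has length at most `1`.
theorem genocchiHermite_isBigO_one (hVo : IsOpen V) (hVc : Convex ℝ V)
    (hh : AnalyticOnNhd ℂ h V) {N : ℕ} {z : Fin N → ℂ} (hz : ∀ k, z k ∈ V) {b : ℂ} (hb : b ∈ V) :
    genocchiHermite h z =O[𝓝 b] fun _ => (1 : ℂ) := by
  obtain ⟨δ, hδ, hsub⟩ := Metric.nhds_basis_closedBall.mem_iff.1 (hVo.mem_nhds hb)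
  have hc := continuous_nodeCenter z
  have hl := continuous_lastParam (N := N)
  obtain ⟨M, hM⟩ := ((isCompact_orderedSimplex N).prod
    (isCompact_closedBall b δ)).exists_bound_of_continuousOn
    (f := fun p : (Fin N → ℝ) × ℂ => iteratedDeriv N h (nodeCenter z p.1 + lastParam p.1 * p.2))
    ((hh.iteratedDeriv_complex N).continuousOn.comp (by fun_prop) fun p hp =>
      nodeCenter_add_mem hVc hz (hsub hp.2) hp.1)
  refine IsBigO.of_bound M ?_
  filter_upwards [Metric.closedBall_mem_nhds b hδ] with w hw
  rw [norm_one, mul_one]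
  exact norm_iterIntegral_le ⟨zero_le_one, le_rfl⟩ fun t ht => hM (t, w) ⟨ht, hw⟩

open Asymptotics Topology in
theorem nodePoly_isBigO {N : ℕ} (z : Fin N → ℂ) (k : Fin N) :
    (fun w => (nodePoly z).eval w) =O[𝓝 (z k)] fun w => (w - z k) ^ nodeMult z k := by
  have hfac : ∀ w, (nodePoly z).eval w = (w - z k) ^ nodeMult z k *
      ∏ i ∈ Finset.univ.filter fun i => ¬ z i = z k, (w - z i) := by
    intro w
    rw [nodePoly, Polynomial.eval_prod, ← Finset.prod_filter_mul_prod_filter_not _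
      (fun i => z i = z k), nodeMult, ← Finset.prod_const]
    simp only [Polynomial.eval_sub, Polynomial.eval_X, Polynomial.eval_C]
    congr 1
    exact Finset.prod_congr rfl fun i hi => by rw [(Finset.mem_filter.1 hi).2]
  simp only [hfac]
  have hcont : Continuous fun w : ℂ =>
      ∏ i ∈ Finset.univ.filter fun i => ¬ z i = z k, (w - z i) := by fun_prop
  simpa using (isBigO_refl (fun w => (w - z k) ^ nodeMult z k) (𝓝 (z k))).mul
    (hcont.continuousAt.norm.isBoundedUnder_le.isBigO_one ℂ)

open Asymptotics Topology in
-- If the multiplicity were smaller than `m`, dividing by the exact power of `w - a` would force the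
-- cofactor to vanish at `a`.
theorem le_rootMultiplicity_of_isBigO {q : Polynomial ℂ} (hq : q ≠ 0) {a : ℂ} {m : ℕ}
    (h : (fun w => q.eval w) =O[𝓝 a] fun w => (w - a) ^ m) : m ≤ q.rootMultiplicity a := by
  by_contra! hlt
  obtain ⟨q₁, hq₁, hnd⟩ := Polynomial.exists_eq_pow_rootMultiplicity_mul_and_not_dvd q hq a
  set r := q.rootMultiplicity a
  have hne : q₁.eval a ≠ 0 := fun h0 => hnd (Polynomial.dvd_iff_isRoot.2 h0)
  obtain ⟨C, hC⟩ := h.bound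
  have hle : ∀ᶠ w in 𝓝[≠] a, ‖q₁.eval w‖ ≤ C * ‖w - a‖ ^ (m - r) := by
    filter_upwards [hC.filter_mono nhdsWithin_le_nhds, self_mem_nhdsWithin] with w hw hwa
    have hpos : 0 < ‖w - a‖ ^ r := pow_pos (norm_pos_iff.2 (sub_ne_zero.2 hwa)) r
    rw [hq₁] at hw
    simp only [Polynomial.eval_mul, Polynomial.eval_pow, Polynomial.eval_sub, Polynomial.eval_X,
      Polynomial.eval_C, norm_mul, norm_pow] at hw
    refine le_of_mul_le_mul_left (hw.trans_eq ?_) hpos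
    rw [mul_left_comm, ← pow_add, Nat.add_sub_cancel' hlt.le]
  have hlim : Filter.Tendsto (fun w => C * ‖w - a‖ ^ (m - r)) (𝓝[≠] a) (𝓝 0) := by
    have hc : Continuous fun w : ℂ => C * ‖w - a‖ ^ (m - r) := by fun_prop
    have := hc.tendsto a
    simp only [sub_self, norm_zero, zero_pow (Nat.sub_ne_zero_of_lt hlt), mul_zero] at this
    exact this.mono_left nhdsWithin_le_nhds
  have := le_of_tendsto_of_tendsto
    ((q₁.continuous.norm.tendsto a).mono_left nhdsWithin_le_nhds) hlim hle
  exact hne (norm_le_zero_iff.1 this)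

open Asymptotics Topology in
/-- Uniqueness in Hermite interpolation. -/
theorem eq_zero_of_isBigO_nodes {N : ℕ} {z : Fin N → ℂ} {q : Polynomial ℂ}
    (hdeg : q.degree < (N : WithBot ℕ))
    (h : ∀ k, (fun w => q.eval w) =O[𝓝 (z k)] fun w => (w - z k) ^ nodeMult z k) : q = 0 := by
  by_contra hq
  -- The nodes are compared with the roots as multisets, so that repeated nodes count with
  -- multiplicity.
  have hle : (Finset.univ : Finset (Fin N)).val.map z ≤ q.roots := by
    rw [Multiset.le_iff_count]
    intro a
    rw [Polynomial.count_roots]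
    by_cases ha : ∃ k, z k = a
    · obtain ⟨k, rfl⟩ := ha
      refine le_trans (le_of_eq ?_) (le_rootMultiplicity_of_isBigO hq (h k))
      rw [Multiset.count_map, nodeMult, Finset.card_def, Finset.filter_val]
      simp only [eq_comm]
    · rw [Multiset.count_eq_zero_of_notMem]
      · exact Nat.zero_le _
      · simpa using ha
  have h1 := (Multiset.card_le_card hle).trans q.card_roots'
  rw [Polynomial.degree_eq_natDegree hq] at hdeg
  simp only [Multiset.card_map, Finset.card_val, Finset.card_univ, Fintype.card_fin] at h1
  exact absurd h1 (not_le.2 (by exact_mod_cast hdeg))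

open Asymptotics Topology in
-- Matching derivatives says that `f - r` has order at least `nodeMult z k` at the node, and `v f -
-- u = v (f - r)` near it.
theorem isBigO_of_interpolates {N : ℕ} {z : Fin N → ℂ} {f : ℂ → ℂ} {u v : Polynomial ℂ}
    (hr : Interpolates (fun w => u.eval w / v.eval w) f z) (hvz : ∀ k, v.eval (z k) ≠ 0)
    (hf : ∀ k, AnalyticAt ℂ f (z k)) (k : Fin N) :
    (fun w => v.eval w * f w - u.eval w) =O[𝓝 (z k)] fun w => (w - z k) ^ nodeMult z k := by
  have hu : AnalyticAt ℂ (fun w => u.eval w) (z k) :=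
    AnalyticOnNhd.eval_polynomial u _ (mem_univ _)
  have hv : AnalyticAt ℂ (fun w => v.eval w) (z k) :=
    AnalyticOnNhd.eval_polynomial v _ (mem_univ _)
  have hra : AnalyticAt ℂ (fun w => u.eval w / v.eval w) (z k) := hu.fun_div hv (hvz k)
  have hord : (nodeMult z k : ℕ∞) ≤
      analyticOrderAt (fun w => f w - u.eval w / v.eval w) (z k) := by
    rw [natCast_le_analyticOrderAt_iff_iteratedDeriv_eq_zero ((hf k).fun_sub hra)]
    intro i hi
    rw [iteratedDeriv_fun_sub (hf k).contDiffAt hra.contDiffAt, hr k i hi, sub_self]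
  obtain ⟨g, hg, hgeq⟩ := (natCast_le_analyticOrderAt ((hf k).fun_sub hra)).1 hord
  have h1 : (fun w => (w - z k) ^ nodeMult z k * (v.eval w * g w)) =O[𝓝 (z k)]
      fun w => (w - z k) ^ nodeMult z k := by
    simpa using (isBigO_refl (fun w => (w - z k) ^ nodeMult z k) (𝓝 (z k))).mul
      ((hv.mul hg).continuousAt.norm.isBoundedUnder_le.isBigO_one ℂ)
  refine h1.congr' ?_ Filter.EventuallyEq.rfl
  filter_upwards [hgeq, hv.continuousAt.eventually_ne (hvz k)] with w hw hvw
  rw [smul_eq_mul] at hw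
  rw [mul_left_comm, ← hw]
  field_simp

/-- The polynomial `p` is the same for matrices of all sizes, so the 1×1 matrix `w 1` gives the
scalar Newton formula for it. -/
theorem sub_eval_newton_eq (hVc : Convex ℝ V) (hh : AnalyticOnNhd ℂ h V)
    {N : ℕ} {z : Fin N → ℂ} (hz : ∀ k, z k ∈ V) {p : Polynomial ℂ}
    (hp : ∀ (n : ℕ) (A : Matrix (Fin n) (Fin n) ℂ), spectrum ℂ A ⊆ V →
        Polynomial.aeval A (nodePoly z) * iterIntegralMatrix N
          (fun t => matFun (iteratedDeriv N h) (nodeMatrix z A t)) 1 =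
        matFun h A - Polynomial.aeval A p) {w : ℂ} (hw : w ∈ V) :
    h w - p.eval w = (nodePoly z).eval w * genocchiHermite h z w := by
  have h1 := hp 1 (w • 1)
    ((spectrum_smul_one_subset _).trans (singleton_subset_iff.2 hw))
  rw [iterIntegralMatrix_smul_one hVc hh hz hw, matFun_smul_one (hh w hw),
    ← Algebra.algebraMap_eq_smul_one w, Polynomial.aeval_algebraMap_apply,
    Polynomial.aeval_algebraMap_apply] at h1
  simpa [Algebra.algebraMap_eq_smul_one, mul_comm] using (congrFun (congrFun h1 0) 0).symm

open Asymptotics Topology in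
-- Identifies the Newton interpolant of `v f` with `u`: both agree with `v f` to the required order
-- at every node and have degree below `N`.
theorem aeval_nodePoly_mul_iterIntegralMatrix {n N : ℕ} (hVo : IsOpen V) (hVc : Convex ℝ V)
    {f : ℂ → ℂ} (hf : AnalyticOnNhd ℂ f V) {z : Fin N → ℂ} (hz : ∀ k, z k ∈ V)
    {u v : Polynomial ℂ} (hr : Interpolates (fun w => u.eval w / v.eval w) f z)
    (hdeg : u.degree < (N : WithBot ℕ)) (hvz : ∀ k, v.eval (z k) ≠ 0)
    {A : Matrix (Fin n) (Fin n) ℂ} (hA : spectrum ℂ A ⊆ V) :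
    Polynomial.aeval A (nodePoly z) * iterIntegralMatrix N (fun t =>
      matFun (iteratedDeriv N fun w => v.eval w * f w) (nodeMatrix z A t)) 1 =
    matFun (fun w => v.eval w * f w) A - Polynomial.aeval A u := by
  have hh : AnalyticOnNhd ℂ (fun w => v.eval w * f w) V := fun w hw =>
    (AnalyticOnNhd.eval_polynomial v w (mem_univ _)).mul (hf w hw)
  obtain ⟨p, hpd, hpA⟩ := exists_newton_interpolant hVo hVc hh hz
  have hup : u - p = 0 := by
    refine eq_zero_of_isBigO_nodes (z := z)
      ((Polynomial.degree_sub_le _ _).trans_lt (max_lt hdeg hpd)) fun k => ?_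
    have h1 := isBigO_of_interpolates hr hvz (fun k => hf _ (hz k)) k
    have h2 : (fun w => v.eval w * f w - p.eval w) =O[𝓝 (z k)]
        fun w => (w - z k) ^ nodeMult z k := by
      have := (nodePoly_isBigO z k).mul (genocchiHermite_isBigO_one hVo hVc hh hz (hz k))
      simp only [mul_one] at this
      refine this.congr' ?_ Filter.EventuallyEq.rfl
      filter_upwards [hVo.mem_nhds (hz k)] with w hw
      exact (sub_eval_newton_eq hVc hh hz hpA hw).symm
    refine (h2.sub h1).congr_left fun w => ?_
    rw [Polynomial.eval_sub]
    ring
  rw [hpA n A hA, sub_eq_zero.1 hup]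

/-- By spectral mapping, `0` is not an eigenvalue of `v(A)`; the mapping theorem used requires a
nonempty spectrum, hence the case split. -/
theorem isUnit_aeval_of_eval_ne_zero {n : ℕ} {A : Matrix (Fin n) (Fin n) ℂ} {v : Polynomial ℂ}
    (hvA : ∀ μ ∈ spectrum ℂ A, v.eval μ ≠ 0) : IsUnit (Polynomial.aeval A v) := by
  cases isEmpty_or_nonempty (Fin n)
  · exact isUnit_of_subsingleton _
  · have h0 : (0 : ℂ) ∉ spectrum ℂ (Polynomial.aeval A v) := by
      rw [spectrum.map_polynomial_aeval_of_nonempty A v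
        (spectrum.nonempty_of_isAlgClosed_of_finiteDimensional ℂ A)]
      rintro ⟨μ, hμ, h⟩
      exact hvA μ hμ h
    rwa [spectrum.zero_notMem_iff] at h0

end RatInterp

/-! ### The error formula -/

theorem theoremt {n N : ℕ} (A : Matrix (Fin n) (Fin n) ℂ) (z : Fin N → ℂ)
    (U : Set ℂ) (hU : IsOpen U)
    (hKU : convexHull ℝ (spectrum ℂ A ∪ Set.range z) ⊆ U)
    (f : ℂ → ℂ) (hf : AnalyticOnNhd ℂ f U)
    (u v : Polynomial ℂ)
    (hr : RatInterp.Interpolates (fun w => u.eval w / v.eval w) f z)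
    (hdeg : u.degree < (N : WithBot ℕ))
    (hvz : ∀ k, v.eval (z k) ≠ 0)
    (hvA : ∀ μ ∈ spectrum ℂ A, v.eval μ ≠ 0) :
    -- the objects on the right-hand side make sense
    IsUnit (Polynomial.aeval A v) ∧
    ContinuousOn
      (fun t => RatInterp.matFun (iteratedDeriv N fun w => v.eval w * f w)
        (RatInterp.nodeMatrix z A t))
      (RatInterp.orderedSimplex N) ∧
    -- the formula for the error
    RatInterp.matFun f A - RatInterp.matFun (fun w => u.eval w / v.eval w) A =
      Polynomial.aeval A (RatInterp.nodePoly z) * (Polynomial.aeval A v)⁻¹ *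
        RatInterp.iterIntegralMatrix N
          (fun t => RatInterp.matFun (iteratedDeriv N fun w => v.eval w * f w)
            (RatInterp.nodeMatrix z A t)) 1 := by
  -- `U` itself need not be convex. The convex hull is compact, so a thickening of it is an open
  -- convex neighbourhood inside `U`.
  obtain ⟨δ, hδ, hδU⟩ := (((Matrix.finite_spectrum A).union
    (Set.finite_range z)).isCompact_convexHull ℝ).exists_thickening_subset_open hU hKU
  set V := Metric.thickening δ (convexHull ℝ (spectrum ℂ A ∪ Set.range z))
  have hVo : IsOpen V := Metric.isOpen_thickening
  have hVc : Convex ℝ V := (convex_convexHull ℝ _).thickening δ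
  have hsub : spectrum ℂ A ∪ Set.range z ⊆ V :=
    (subset_convexHull ℝ _).trans (Metric.self_subset_thickening hδ _)
  have hA : spectrum ℂ A ⊆ V := Set.subset_union_left.trans hsub
  have hz : ∀ k, z k ∈ V := fun k => hsub (Or.inr ⟨k, rfl⟩)
  have hfV : AnalyticOnNhd ℂ f V := hf.mono hδU
  have hpoly (p : Polynomial ℂ) : AnalyticOnNhd ℂ (fun w => p.eval w) Set.univ :=
    AnalyticOnNhd.eval_polynomial p
  have hh : AnalyticOnNhd ℂ (fun w => v.eval w * f w) V := fun w hw =>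
    (hpoly v w (Set.mem_univ _)).mul (hfV w hw)
  have hv := RatInterp.isUnit_aeval_of_eval_ne_zero hvA
  refine ⟨hv, RatInterp.continuousOn_matFun_nodeMatrix hVo hVc hA
    (hh.iteratedDeriv_complex N) hz, ?_⟩
  have hkey := RatInterp.aeval_nodePoly_mul_iterIntegralMatrix hVo hVc hfV hz hr hdeg hvz hA
  have hra : AnalyticOnNhd ℂ (fun w => u.eval w / v.eval w) (spectrum ℂ A) := fun μ hμ =>
    (hpoly u μ (Set.mem_univ _)).fun_div (hpoly v μ (Set.mem_univ _)) (hvA μ hμ)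
  -- `v (u / v) = u` holds only where `v ≠ 0`, which is an open set containing the spectrum.
  have hvu : Polynomial.aeval A v * RatInterp.matFun (fun w => u.eval w / v.eval w) A =
      Polynomial.aeval A u := by
    rw [← RatInterp.matFun_eval_mul hra, ← RatInterp.matFun_eval u]
    refine (RatInterp.matFun_congr (V := {w | v.eval w ≠ 0})
      (isOpen_ne_fun v.continuous continuous_const) hvA ((hpoly u).mono (Set.subset_univ _))
      fun w hw => ?_).symm
    exact (mul_div_cancel₀ _ hw).symm
  rw [RatInterp.matFun_eval_mul (hfV.mono hA), ← hvu, ← mul_sub] at hkey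
  rw [Matrix.isUnit_iff_isUnit_det] at hv
  have hcomm : Polynomial.aeval A (RatInterp.nodePoly z) * (Polynomial.aeval A v)⁻¹ =
      (Polynomial.aeval A v)⁻¹ * Polynomial.aeval A (RatInterp.nodePoly z) := by
    have h1 : Polynomial.aeval A v * Polynomial.aeval A (RatInterp.nodePoly z) =
        Polynomial.aeval A (RatInterp.nodePoly z) * Polynomial.aeval A v := by
      rw [← map_mul, ← map_mul, mul_comm]
    have h2 := congrArg (fun M => (Polynomial.aeval A v)⁻¹ * M * (Polynomial.aeval A v)⁻¹) h1
    simpa only [← mul_assoc, Matrix.nonsing_inv_mul _ hv, one_mul,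
      Matrix.mul_nonsing_inv_cancel_right _ _ hv] using h2
  rw [hcomm, mul_assoc, hkey, ← mul_assoc, Matrix.nonsing_inv_mul _ hv, one_mul]
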